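/- **Setting.** Let $N\ge 2$ agents have decisions $x_i\in\mathbb R^n$; write $x=\mathrm{col}(x_i)\in\mathbb R^{Nn}$ (Euclidean norm) and $\sigma(x)=\frac1N\sum_j x_j$. Agent $i$ has cost $\bar J_i(x)=J_i(x_i,\sigma(x))$, private set $\Omega_i\subset\mathbb R^n$, and data $A_i\in\mathbb R^{m\times n}$, $b_i\in\mathbb R^m$. Put $\Omega=\prod_i\Omega_i$, $A=[A_1,\dots,A_N]$, $b=\sum_i b_i$, $K=\Omega\cap\{x: Ax\le b\}$. Let $F(x)=\mathrm{col}(\nabla_{x_i}\bar J_i(x))$ be the pseudo-gradient, and let $\mathbf F(x,u)=\mathrm{col}(\nabla_{x_i}J_i(x_i,u_i))$ be the extended pseudo-gradient, where $\nabla_{x_i}J_i(x_i,u_i)$ is the gradient at $z=x_i$ of $z\mapsto J_i\big(z,u_i+\tfrac1N(z-x_i)\big)$; for differentiable $J_i$ it equals $\nabla_{x_i}J_i(x_i,y)+\frac1N\nabla_yJ_i(x_i,y)$ at $y=u_i$. A profile $x^*\in K$ is a generalized Nash equilibrium (GNE) if, for every $i$, $x_i^*$ minimizes $\bar J_i(\cdot,x^*_{-i})$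 subject to $(\cdot,x_{-i}^*)\in K$; it is a variational GNE if $\langle F(x^*),x-x^*\rangle\ge 0$ for all $x\in K$. A pair $(x^*,\lambda^*)$ satisfies the KKT conditions if $0\in F(x^*)+A^T\lambda^*+\prod_i N_{\Omega_i}(x^*_i)$ and $0\in-(Ax^*-b)+N_{\mathbb R^m_+}(\lambda^*)$, where $N$ denotes the normal cone. **Assumptions.** (i) For all $i$ and $x_{-i}$, $\bar J_i(\cdot,x_{-i})$ is $C^1$ and convex; each $\Omega_i$ is compact and convex; $K$ is nonempty and satisfies Slater's condition (for these affine constraints: some point of $K$ lies in the relative interior of $\Omega$). (ii) $F$ is $\mu$-strongly monotone ($\mu>0$) and $l_F$-Lipschitz on $\mathbb R^{Nn}$. (iii) The communication graph $G$ on the agents is undirected and connected, with unit weights; $\mathcal N_i$ are the neighbours of $i$, $d_i=|\mathcal N_i|$, and $L$ is the Laplacian with eigenvalues $0=\lambda_1(L)\le\lambda_2(L)\le\dots\le\lambda_N(L)$. (iv) There are $l_F^u,l_F^x>0$ with $\|\mathbf F(x,u)-\mathbf F(x,v)\|\le l_F^u\|u-v\|$ and $\|\mathbf F(x,u)-\mathbf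 F(y,u)\|\le l_F^x\|x-y\|$ for all $x,y,u,v\in\mathbb R^{Nn}$. **Algorithm** (gain $c>0$, constant step sizes $\kappa,\tau_i,\upsilon_i,\alpha_i>0$). Start from $x_{i,0}\in\Omega_i$, $u_{i,0}=x_{i,0}$ and arbitrary $z_{i,0},\lambda_{i,0}\in\mathbb R^m$, and for $k\ge 0$ set, for every $i$, $$\begin{aligned} x_{i,k+1}&=P_{\Omega_i}\Big[x_{i,k}-\tau_i\Big(\nabla_{x_i}J_i(x_{i,k},u_{i,k})+A_i^T\lambda_{i,k}+c\sum_{j\in\mathcal N_i}(u_{i,k}-u_{j,k})\Big)\Big],\\ u_{i,k+1}&=u_{i,k}-\kappa c\sum_{j\in\mathcal N_i}(u_{i,k}-u_{j,k})+(x_{i,k+1}-x_{i,k}),\\ z_{i,k+1}&=z_{i,k}+\upsilon_i\sum_{j\in\mathcal N_i}(\lambda_{i,k}-\lambda_{j,k}),\\ \lambda_{i,k+1}&=P_{\mathbb R^m_+}\Big(\lambda_{i,k}-\alpha_i\Big[\sum_{j\in\mathcal N_i}(\lambda_{i,k}-\lambda_{j,k})+b_i-A_i(2x_{i,k+1}-x_{i,k})+\sum_{j\in\mathcal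 N_i}\big((2z_{i,k+1}-z_{i,k})-(2z_{j,k+1}-z_{j,k})\big)\Big]\Big). \end{aligned}$$ **Theorem.** Assume (i)–(iv) and $c\lambda_2(L)>\frac{(l_F^u)^2}{4\mu}$. Let $$\tilde\mu=\lambda_{\min}\begin{bmatrix}\mu&-l_F^u/2\\-l_F^u/2&c\lambda_2(L)\end{bmatrix},\quad \theta^2=\max\{(l_F^x)^2,(l_F^u)^2+(c\lambda_N(L))^2\},\quad \beta=\min\Big\{\frac{\tilde\mu}{\theta^2},\frac1{\lambda_N(L)}\Big\}.$$ Take any $\delta>\frac1{2\beta}$, $0<\kappa<\frac1\delta$, and positive $\tau_i,\upsilon_i,\alpha_i$ with $$\tau_i\le\frac1{\max_{j}\sum_{k}|[A_i^T]_{jk}|+\delta+\frac1{\kappa(1-\kappa\delta)}},\qquad \upsilon_i\le\frac1{2d_i+\delta},\qquad \alpha_i\le\frac1{\max_{j}\sum_{k}|[A_i]_{jk}|+2d_i+\delta}.$$ Then there is a unique variational GNE $x^*$, it is a GNE, and for every sequence generated by the algorithm: $x_{i,k}\to x^*_i$ and $u_{i,k}\to\sigma(x^*)$ for all $i$, and there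 is a $\lambda^*\in\mathbb R^m$ such that $(x^*,\lambda^*)$ satisfies the KKT conditions and $\lambda_{i,k}\to\lambda^*$ for all $i$. -/

import Mathlib

open scoped InnerProductSpace

noncomputable section

/-- Real Euclidean space of dimension `d`. -/
abbrev Euc (d : ℕ) : Type := EuclideanSpace ℝ (Fin d)

/-- Stacked vectors `col(x_1, …, x_N)` with blocks in `ℝ^d`; the norm and the inner product are
the Euclidean ones of `ℝ^{Nd}`. -/
abbrev Profile (N d : ℕ) : Type := PiLp 2 (fun _ : Fin N => Euc d)

/-- The profile `(z, x_{-i})`: the `i`-th block of `x` is replaced by `z`. -/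
def Profile.replace {N d : ℕ} (x : Profile N d) (i : Fin N) (z : Euc d) : Profile N d :=
  WithLp.toLp 2 (Function.update x.ofLp i z)

/-- The average `σ(x) = (1/N) ∑ j, x_j`. -/
def Profile.avg {N d : ℕ} (x : Profile N d) : Euc d := (1 / (N : ℝ)) • ∑ j, x j

/-- The nonnegative orthant `ℝ^d_+`. -/
def orthant (d : ℕ) : Set (Euc d) := {v | ∀ j, 0 ≤ v j}

/-- The normal cone of `S` at `x` (empty when `x ∉ S`). -/
def normalCone {d : ℕ} (S : Set (Euc d)) (x : Euc d) : Set (Euc d) :=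
  {v | x ∈ S ∧ ∀ y ∈ S, ⟪v, y - x⟫_ℝ ≤ 0}

/-- The Euclidean projection `P_S(y) = argmin_{p ∈ S} ‖y - p‖`; the minimizer exists and is unique
when `S` is nonempty, closed and convex. -/
def proj {d : ℕ} (S : Set (Euc d)) (y : Euc d) : Euc d :=
  Classical.epsilon fun p => p ∈ S ∧ ∀ w ∈ S, ‖y - p‖ ≤ ‖y - w‖

/-- The `k`-th smallest eigenvalue, `k = 0, 1, …`, of a real symmetric matrix, counted with
multiplicity (Mathlib's `eigenvalues₀` are listed in decreasing order). -/
def eigAsc {p : ℕ} (M : Matrix (Fin p) (Fin p) ℝ) (hM : M.IsHermitian) (k : Fin p) : ℝ :=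
  hM.eigenvalues₀ (Fin.cast (Fintype.card_fin p).symm k.rev)

/-- The data of an average aggregative game with `N` players, actions in `ℝ^n` and `m` affine
coupling constraints `∑ i, A_i x_i ≤ ∑ i, b_i`. -/
structure AggGame (N n m : ℕ) where
  /-- the costs `J_i(x_i, y)`, where `y` is the value of the aggregate -/
  J : Fin N → Euc n → Euc n → ℝ
  /-- the private feasible sets `Ω_i` -/
  Ω : Fin N → Set (Euc n)
  /-- the matrices `A_i` of the coupling constraint -/
  A : Fin N → Matrix (Fin m) (Fin n) ℝ
  /-- the vectors `b_i` of the coupling constraint -/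
  b : Fin N → Euc m

namespace AggGame

variable {N n m : ℕ}

/-- The cost as a function of the whole profile, `J_i(x_i, σ(x))`. -/
def Jbar (g : AggGame N n m) (i : Fin N) (x : Profile N n) : ℝ := g.J i (x i) x.avg

/-- The residual `A x - b = ∑ i, A_i x_i - ∑ i, b_i`. -/
def residual (g : AggGame N n m) (x : Profile N n) : Euc m :=
  ∑ i, Matrix.toEuclideanLin (g.A i) (x i) - ∑ i, g.b i

/-- The globally shared feasible set `K`. -/
def K (g : AggGame N n m) : Set (Profile N n) :=
  {x | (∀ i, x i ∈ g.Ω i) ∧ ∀ j, g.residual x j ≤ 0}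

/-- The pseudo-gradient `F(x) = col(∇_{x_i} J_i(x_i, σ(x)))`; player `i` differentiates with
respect to its own action, which also enters through the average. -/
def pseudoGrad (g : AggGame N n m) (x : Profile N n) : Profile N n :=
  WithLp.toLp 2 fun i => gradient (fun z => g.Jbar i (x.replace i z)) (x i)

/-- Player `i`'s partial gradient `∇_{x_i} J_i(x_i, u_i)` in which the aggregate is evaluated at
the estimate `w` while its dependence on the own action, with derivative `1/N`, is kept: the
gradient at `z = a` of `z ↦ J_i(z, w + (z - a) / N)`. -/
def partialGrad (g : AggGame N n m) (i : Fin N) (a w : Euc n) : Euc n :=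
  gradient (fun z => g.J i z (w + (1 / (N : ℝ)) • (z - a))) a

/-- For a differentiable cost, `partialGrad` is
`∇_{x_i} J_i(x_i, y) + (1/N) ∇_y J_i(x_i, y)` at `y = w`. -/
theorem partialGrad_eq (g : AggGame N n m) (i : Fin N) (a w : Euc n)
    (h : DifferentiableAt ℝ (fun p : Euc n × Euc n => g.J i p.1 p.2) (a, w)) :
    g.partialGrad i a w =
      gradient (fun z => g.J i z w) a + (1 / (N : ℝ)) • gradient (fun y => g.J i a y) w := by
  have hc1 : HasFDerivAt (fun z : Euc n => (z, w + (1 / (N : ℝ)) • (z - a)))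
      ((ContinuousLinearMap.id ℝ (Euc n)).prod
        ((1 / (N : ℝ)) • ContinuousLinearMap.id ℝ (Euc n))) a := by
    have h0 : HasFDerivAt (fun z : Euc n => z - a) (ContinuousLinearMap.id ℝ (Euc n)) a :=
      (hasFDerivAt_id a).sub_const a
    have h0' : HasFDerivAt (fun z : Euc n => (1 / (N : ℝ)) • (z - a))
        ((1 / (N : ℝ)) • ContinuousLinearMap.id ℝ (Euc n)) a := h0.fun_const_smul _
    exact (hasFDerivAt_id a).prodMk (h0'.const_add w)
  have h1 : HasFDerivAt (fun z : Euc n => (z, w))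
      ((ContinuousLinearMap.id ℝ (Euc n)).prod (0 : Euc n →L[ℝ] Euc n)) a :=
    (hasFDerivAt_id a).prodMk (hasFDerivAt_const w a)
  have h2 : HasFDerivAt (fun y : Euc n => (a, y))
      ((0 : Euc n →L[ℝ] Euc n).prod (ContinuousLinearMap.id ℝ (Euc n))) w :=
    (hasFDerivAt_const a w).prodMk (hasFDerivAt_id w)
  have hc1' : w + (1 / (N : ℝ)) • (a - a) = w := by simp
  have e0 := (HasFDerivAt.comp a (by simpa only [hc1'] using h.hasFDerivAt) hc1).fderiv
  have e1 := (HasFDerivAt.comp a h.hasFDerivAt h1).fderiv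
  have e2 := (HasFDerivAt.comp w h.hasFDerivAt h2).fderiv
  simp only [Function.comp_def] at e0 e1 e2
  simp only [partialGrad, gradient]
  rw [← map_smul, ← map_add]
  congr 1
  rw [e0, e1, e2]
  ext v
  simp only [ContinuousLinearMap.comp_apply, _root_.add_apply,
    _root_.smul_apply, ContinuousLinearMap.prod_apply, ContinuousLinearMap.id_apply,
    _root_.zero_apply, ← map_smul, ← map_add]
  simp

/-- The extended pseudo-gradient `𝐅(x, u) = col(∇_{x_i} J_i(x_i, u_i))`. -/
def extPseudoGrad (g : AggGame N n m) (x u : Profile N n) : Profile N n :=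
  WithLp.toLp 2 fun i => g.partialGrad i (x i) (u i)

/-- Costs that are continuously differentiable and convex in the own action, compact convex private
sets, and Slater's constraint qualification for the affine coupling constraints: some point of `K`
lies in the relative interior of `∏ i, Ω_i` (in particular `K` is nonempty). This holds as soon as
some point of `∏ i, Ω_i` satisfies the coupling constraints strictly. -/
structure Regular (g : AggGame N n m) : Prop where
  contDiff : ∀ (i : Fin N) (x : Profile N n), ContDiff ℝ 1 fun z => g.Jbar i (x.replace i z)
  convexOn : ∀ (i : Fin N) (x : Profile N n),
    ConvexOn ℝ Set.univ fun z => g.Jbar i (x.replace i z)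
  isCompact : ∀ i, IsCompact (g.Ω i)
  convex : ∀ i, Convex ℝ (g.Ω i)
  slater : ∃ x ∈ g.K, ∀ i, x i ∈ intrinsicInterior ℝ (g.Ω i)

/-- Generalized Nash equilibrium. -/
def IsGNE (g : AggGame N n m) (x : Profile N n) : Prop :=
  x ∈ g.K ∧ ∀ (i : Fin N) (z : Euc n), x.replace i z ∈ g.K → g.Jbar i x ≤ g.Jbar i (x.replace i z)

/-- Variational generalized Nash equilibrium: a solution of `VI(F, K)`. -/
def IsVariationalGNE (g : AggGame N n m) (x : Profile N n) : Prop :=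
  x ∈ g.K ∧ ∀ y ∈ g.K, 0 ≤ ⟪g.pseudoGrad x, y - x⟫_ℝ

/-- The KKT conditions of `VI(F, K)`:
`0 ∈ F(x) + Aᵀ l + ∏ i, N_{Ω_i}(x_i)` and `0 ∈ -(A x - b) + N_{ℝ^m_+}(l)`. -/
def IsKKT (g : AggGame N n m) (x : Profile N n) (l : Euc m) : Prop :=
  (∀ i, -(g.pseudoGrad x i + Matrix.toEuclideanLin (g.A i).transpose l) ∈ normalCone (g.Ω i) (x i)) ∧
    g.residual x ∈ normalCone (orthant m) l

end AggGame

section Graph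

variable {N : ℕ}

/-- The smallest but one eigenvalue `λ_2(L)` of the Laplacian of the graph. -/
def lambdaTwo (hN : 2 ≤ N) (G : SimpleGraph (Fin N)) [DecidableRel G.Adj] : ℝ :=
  eigAsc (G.lapMatrix ℝ) (G.posSemidef_lapMatrix ℝ).isHermitian ⟨1, by omega⟩

/-- The largest eigenvalue `λ_N(L)` of the Laplacian of the graph. -/
def lambdaMax (hN : 2 ≤ N) (G : SimpleGraph (Fin N)) [DecidableRel G.Adj] : ℝ :=
  eigAsc (G.lapMatrix ℝ) (G.posSemidef_lapMatrix ℝ).isHermitian ⟨N - 1, by omega⟩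

/-- The disagreement `∑_{j ∈ N_i} (w_i - w_j)` of agent `i` with its neighbours. -/
def disagreement {d : ℕ} (G : SimpleGraph (Fin N)) [DecidableRel G.Adj] (w : Profile N d)
    (i : Fin N) : Euc d :=
  ∑ j ∈ G.neighborFinset i, (w i - w j)

end Graph

/-- The matrix `!![a, -l/2; -l/2, e]` is symmetric. -/
theorem isHermitian_balance (a l e : ℝ) :
    (!![a, -l / 2; -l / 2, e] : Matrix (Fin 2) (Fin 2) ℝ).IsHermitian := by
  ext i j
  fin_cases i <;> fin_cases j <;> simp

/-- The smallest eigenvalue of `!![μ, -lu/2; -lu/2, cλ₂]`. -/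
def muTilde (μ lu cl2 : ℝ) : ℝ := eigAsc !![μ, -lu / 2; -lu / 2, cl2] (isHermitian_balance μ lu cl2) 0

/-- The restricted cocoercivity constant `β = min {μ̃ / θ², 1 / λ_N(L)}`, where
`θ² = max {lx², lu² + (c λ_N(L))²}`. -/
def betaConst {N : ℕ} (hN : 2 ≤ N) (G : SimpleGraph (Fin N)) [DecidableRel G.Adj]
    (μ lu lx c : ℝ) : ℝ :=
  min (muTilde μ lu (c * lambdaTwo hN G) / max (lx ^ 2) (lu ^ 2 + (c * lambdaMax hN G) ^ 2))
    (1 / lambdaMax hN G)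

/-- The step sizes are positive and satisfy the decentralized upper bounds with parameter `δ`. -/
structure StepSizesOK {N n m : ℕ} (g : AggGame N n m) (G : SimpleGraph (Fin N))
    [DecidableRel G.Adj] (δ κ : ℝ) (τ υ α : Fin N → ℝ) : Prop where
  tau_pos : ∀ i, 0 < τ i
  upsilon_pos : ∀ i, 0 < υ i
  alpha_pos : ∀ i, 0 < α i
  tau_le : ∀ i, τ i ≤
    1 / ((⨆ j : Fin n, ∑ k : Fin m, |(g.A i).transpose j k|) + δ + 1 / (κ * (1 - κ * δ)))
  upsilon_le : ∀ i, υ i ≤ (2 * (G.degree i : ℝ) + δ)⁻¹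
  alpha_le : ∀ i, α i ≤
    ((⨆ j : Fin m, ∑ k : Fin n, |g.A i j k|) + 2 * (G.degree i : ℝ) + δ)⁻¹

/-- The sequences `(x_k, u_k, z_k, λ_k)` are generated by the distributed algorithm with gain `c`
and constant step sizes `κ, τ_i, υ_i, α_i`, from `x_{i,0} ∈ Ω_i`, `u_{i,0} = x_{i,0}` and arbitrary
`z_{i,0}`, `λ_{i,0}`. -/
structure IsRun {N n m : ℕ} (g : AggGame N n m) (G : SimpleGraph (Fin N)) [DecidableRel G.Adj]
    (c κ : ℝ) (τ υ α : Fin N → ℝ) (x u : ℕ → Profile N n) (z lam : ℕ → Profile N m) : Prop where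
  x_zero : ∀ i, x 0 i ∈ g.Ω i
  u_zero : ∀ i, u 0 i = x 0 i
  x_succ : ∀ k i, x (k + 1) i = proj (g.Ω i)
    (x k i - τ i • (g.partialGrad i (x k i) (u k i) + Matrix.toEuclideanLin (g.A i).transpose (lam k i)
      + c • disagreement G (u k) i))
  u_succ : ∀ k i, u (k + 1) i =
    u k i - (κ * c) • disagreement G (u k) i + (x (k + 1) i - x k i)
  z_succ : ∀ k i, z (k + 1) i = z k i + υ i • disagreement G (lam k) i
  lam_succ : ∀ k i, lam (k + 1) i = proj (orthant m)
    (lam k i - α i • (disagreement G (lam k) i + g.b i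
      - Matrix.toEuclideanLin (g.A i) ((2 : ℝ) • x (k + 1) i - x k i)
      + disagreement G ((2 : ℝ) • z (k + 1) - z k) i))

end

/-! In the variable v = u - x the algorithm is a preconditioned forward-backward iteration.
Projections and extrapolations form the resolvent of a monotone operator (normal cones plus skew
couplings through A and L) in the metric `precondForm`. The forward operator on (x, v, z, λ) is
(𝐅(x,u) + cLu, cLu, 0, Lλ), up to constants. The step-size bounds make the metric coercive by
diagonal dominance (`StepSizesOK.precondForm_ge`), with weights D = δ + 1/(κ(1-κδ)), 1/κ, δ, δ.

The forward operator is controlled on the subspace σ(u) = σ(x), which the iteration preserves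
(`IsRun.avg_eq`). With X = ‖x - x*‖ and U the distance of u to consensus, strong monotonicity and
λ₂(L) give a forward product of at least μX² - l_F^u XU + cλ₂U² ≥ μ̃(X² + U²). The primal forward
error, squared in the dual metric, is at most (θ²/δ)(X² + U²); this is the scalar estimate
`forward_step_bound`. As δ > θ²/(2μ̃), a positive multiple of X² + U² is left over
(`AggGame.forward_cocoercive`). The dual part Lλ is cocoercive with constant 1/λ_N(L).

Hence the preconditioned distance to every stationary point over x* decreases
(`IsRun.lyapunov_succ_le`), by an amount that forces x → x*, u → consensus and vanishing dual
increments. A cluster point of (z, λ) is stationary (`IsRun.isStationary_of_cluster`); measured from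
it, the monotone distance tends to 0 along a subsequence, hence along the whole sequence.

The point x* exists by Banach's fixed point theorem. Its multiplier comes from Lagrange duality for
affine constraints under weak Slater (`exists_multipliers`), and surjectivity of L onto zero-sum
profiles supplies the z-component (`AggGame.IsKKT.exists_isStationary`). -/

noncomputable section

/-! ### Scalar estimate of the forward step. -/

section ScalarInequality

/-- A polynomial inequality on the unit square. -/
theorem step_polynomial_nonneg {s p : ℝ} (hs0 : 0 ≤ s) (hs1 : s ≤ 1) (hp0 : 0 ≤ p) (hp1 : p ≤ 1) :
    s * (1 - s) * (1 + 2 * p - p ^ 2) ^ 2 + s * (1 + s - s ^ 2) * (1 - p ^ 2) ^ 2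
      ≤ 1 + s - s ^ 2 := by
  -- For small s the crude bounds s(1-s) ≤ 1/4 and s ≤ 3/5 suffice. For larger s a square is
  -- completed, and the remainder needs -s³ + 3s² + 2s - 2 ≥ 0, which holds from 3/5 on.
  rcases le_total s (3 / 5) with h | h
  · have h1 : 5 * (s * (1 - s)) ≤ 1 + s - s ^ 2 := by nlinarith [sq_nonneg (s - 1 / 2)]
    have h0 : 0 ≤ 1 + s - s ^ 2 := by nlinarith
    have h2 : (1 + 2 * p - p ^ 2) ^ 2 / 5 + 3 / 5 * (1 - p ^ 2) ^ 2 ≤ 1 := by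
      have h3 : p * (1 - p) ≤ 1 / 4 := by nlinarith [sq_nonneg (p - 1 / 2)]
      have h4 : 0 ≤ p * (1 - p) := mul_nonneg hp0 (by linarith)
      have h5 : p * (1 - p) * (1 - p ^ 2) ≤ 1 / 4 * 1 :=
        mul_le_mul h3 (by nlinarith) (by nlinarith) (by norm_num)
      nlinarith
    have h6 : s * (1 - s) * (1 + 2 * p - p ^ 2) ^ 2
        ≤ (1 + s - s ^ 2) / 5 * (1 + 2 * p - p ^ 2) ^ 2 :=
      mul_le_mul_of_nonneg_right (by linarith) (sq_nonneg _)
    have h7 : s * ((1 + s - s ^ 2) * (1 - p ^ 2) ^ 2)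
        ≤ 3 / 5 * ((1 + s - s ^ 2) * (1 - p ^ 2) ^ 2) :=
      mul_le_mul_of_nonneg_right h (mul_nonneg h0 (sq_nonneg _))
    have h8 := mul_le_mul_of_nonneg_left h2 h0
    nlinarith
  · have hp2 : p ^ 2 ≤ 1 := by nlinarith
    have hp2' : 0 ≤ p ^ 2 := sq_nonneg p
    -- Lowering -4sp² to -4s makes the expression affine in p², so only p² = 0 (`e2`) and p² = 1
    -- (`e3`) have to be checked.
    have hk : 0 ≤ 2 * s ^ 2 * (1 - s) + p ^ 2 * (s ^ 3 + s ^ 2 + 6 * s - 2 - 4 * s * p ^ 2) := by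
      have e1 : p ^ 2 * (s ^ 3 + s ^ 2 + 2 * s - 2)
          ≤ p ^ 2 * (s ^ 3 + s ^ 2 + 6 * s - 2 - 4 * s * p ^ 2) :=
        mul_le_mul_of_nonneg_left (by nlinarith) hp2'
      have e2 : 0 ≤ 2 * s ^ 2 * (1 - s) := by
        have := sq_nonneg s
        exact mul_nonneg (by linarith) (by linarith)
      have e3 : 0 ≤ - s ^ 3 + 3 * s ^ 2 + 2 * s - 2 := by
        nlinarith [mul_nonneg (sub_nonneg.2 h) (sub_nonneg.2 hs1),
          mul_nonneg (mul_nonneg hs0 (sub_nonneg.2 h)) (sub_nonneg.2 hs1)]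
      nlinarith [mul_nonneg (sub_nonneg.2 hp2) e2, mul_nonneg hp2' e3]
    have hmain : (1 + s) * (1 + s - s ^ 2 - (s * (1 - s) * (1 + 2 * p - p ^ 2) ^ 2
        + s * (1 + s - s ^ 2) * (1 - p ^ 2) ^ 2))
        = ((1 - s) * (1 + s) - 2 * s * p * (1 - p ^ 2)) ^ 2
          + p ^ 2 * s * (2 * s ^ 2 * (1 - s)
            + p ^ 2 * (s ^ 3 + s ^ 2 + 6 * s - 2 - 4 * s * p ^ 2)) := by ring
    have hnn : 0 ≤ (1 + s) * (1 + s - s ^ 2 - (s * (1 - s) * (1 + 2 * p - p ^ 2) ^ 2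
        + s * (1 + s - s ^ 2) * (1 - p ^ 2) ^ 2)) := by
      rw [hmain]
      exact add_nonneg (sq_nonneg _) (mul_nonneg (mul_nonneg hp2' hs0) hk)
    have := nonneg_of_mul_nonneg_right hnn (by linarith : (0 : ℝ) < 1 + s)
    linarith

/-- The forward step is controlled by the restricted strong monotonicity constant, up to the
step-size parameter `δ`. -/
theorem forward_step_bound {δ κ lx lu g θ X U a b : ℝ} (hδ : 0 < δ) (hκ : 0 < κ) (hκδ : κ * δ < 1)
    (hlu : 0 ≤ lu) (hg : 0 ≤ g) (hθ : 0 < θ) (hxθ : lx ≤ θ)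
    (hugθ : lu ^ 2 + g ^ 2 ≤ θ ^ 2) (hX : 0 ≤ X) (hU : 0 ≤ U) (ha0 : 0 ≤ a) (hb0 : 0 ≤ b)
    (ha : a ≤ lx * X + lu * √(X ^ 2 + U ^ 2)) (hb : b ≤ g * U) :
    δ * ((δ + 1 / (κ * (1 - κ * δ)))⁻¹ * (a + b) ^ 2 + κ * b ^ 2) ≤ θ ^ 2 * (X ^ 2 + U ^ 2) := by
  set s := κ * δ with hs
  have hs0 : 0 < s := mul_pos hκ hδ
  have h1s : 0 < 1 - s := by linarith
  have hm : 0 < 1 + s - s ^ 2 := by nlinarith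
  -- After scaling by δ both weights depend on s = κδ alone.
  have hcoef : δ * (δ + 1 / (κ * (1 - s)))⁻¹ = s * (1 - s) / (1 + s - s ^ 2) := by
    have : δ + 1 / (κ * (1 - s)) = (1 + s - s ^ 2) / (κ * (1 - s)) := by
      rw [eq_div_iff (mul_pos hκ h1s).ne', add_mul, one_div,
        inv_mul_cancel₀ (mul_pos hκ h1s).ne', hs]
      ring
    rw [this, inv_div, mul_div_assoc', hs]
    ring
  set R := √(X ^ 2 + U ^ 2) with hR
  have hR2 : R ^ 2 = X ^ 2 + U ^ 2 := Real.sq_sqrt (by positivity)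
  have hR0 : 0 ≤ R := Real.sqrt_nonneg _
  rw [← hR2]
  rcases hR0.eq_or_lt with hR00 | hRpos
  · have hX0 : X = 0 := by rw [← hR00] at hR2; nlinarith
    have hU0 : U = 0 := by rw [← hR00] at hR2; nlinarith
    rw [← hR00, hX0] at ha
    rw [hU0] at hb
    have ha' : a = 0 := by linarith
    have hb' : b = 0 := by linarith
    simp [ha', hb', ← hR00]
  have hUR : U ≤ R := Real.le_sqrt_of_sq_le (by nlinarith)
  have hgθ : g ≤ θ := abs_le_of_sq_le_sq' (by nlinarith) hθ.le |>.2
  set W := θ * R with hW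
  have hWpos : 0 < W := mul_pos hθ hRpos
  have hgU : g * U ≤ W := mul_le_mul hgθ hUR hU hθ.le
  have hgU0 : 0 ≤ g * U := mul_nonneg hg hU
  -- Normalization: W bounds gU and q is the fraction used. With p = √(1 - q) the bounds become a ≤
  -- 2Wp and b ≤ W(1 - p²), which is the shape of the polynomial inequality.
  obtain ⟨q, hq⟩ : ∃ q, q = g * U / W := ⟨_, rfl⟩
  have hq0 : 0 ≤ q := hq ▸ div_nonneg hgU0 hWpos.le
  have hq1 : q ≤ 1 := hq ▸ (div_le_one hWpos).2 hgU
  have hqW : g * U = W * q := by rw [hq]; field_simp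
  obtain ⟨p, hp⟩ : ∃ p, p = √(1 - q) := ⟨_, rfl⟩
  have hp0 : 0 ≤ p := hp ▸ Real.sqrt_nonneg _
  have hp2 : p ^ 2 = 1 - q := hp ▸ Real.sq_sqrt (by linarith)
  have hp1 : p ≤ 1 := by nlinarith
  -- By (s+t)² ≤ 2s² + 2t² the square is at most 4θ²R² - 2(θ²U² + g²R²), and AM-GM gives θ²U² + g²R²
  -- ≥ 2W·gU.
  have hXu : lx * X + lu * R ≤ 2 * W * p := by
    have e0 : 0 ≤ θ * X := mul_nonneg hθ.le hX
    have e1 : lx * X ≤ θ * X := mul_le_mul_of_nonneg_right hxθ hX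
    have e2 : 0 ≤ lu * R := mul_nonneg hlu hR0
    suffices h : θ * X + lu * R ≤ 2 * W * p by linarith
    refine abs_le_of_sq_le_sq' ?_ (by positivity) |>.2
    have e3 : (2 * W * p) ^ 2 = 4 * W ^ 2 - 4 * W * (g * U) := by
      rw [hqW]; linear_combination 4 * W ^ 2 * hp2
    rw [e3]
    have e4 : (lu * R) ^ 2 ≤ (θ ^ 2 - g ^ 2) * R ^ 2 := by
      rw [mul_pow]
      exact mul_le_mul_of_nonneg_right (by linarith) (sq_nonneg _)
    have e5 : (θ * X) ^ 2 = θ ^ 2 * R ^ 2 - θ ^ 2 * U ^ 2 := by rw [hR2]; ring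
    have e6 : W ^ 2 = θ ^ 2 * R ^ 2 := by rw [hW]; ring
    have e7 : W * (g * U) = (θ * U) * (g * R) := by rw [hW]; ring
    rw [mul_assoc 4 W, e7, e6]
    linarith [sq_nonneg (θ * X - lu * R), sq_nonneg (θ * U - g * R)]
  have hB : b ≤ W * (1 - p ^ 2) := by rw [hp2]; linarith
  have hA : a + b ≤ W * (1 + 2 * p - p ^ 2) := by linarith
  have hA2 : (a + b) ^ 2 ≤ W ^ 2 * (1 + 2 * p - p ^ 2) ^ 2 := by
    rw [← mul_pow]; exact pow_le_pow_left₀ (by positivity) hA 2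
  have hB2 : b ^ 2 ≤ W ^ 2 * (1 - p ^ 2) ^ 2 := by
    rw [← mul_pow]; exact pow_le_pow_left₀ hb0 hB 2
  have key := step_polynomial_nonneg hs0.le (by linarith) hp0 hp1
  have e8 : δ * ((δ + 1 / (κ * (1 - s)))⁻¹ * (a + b) ^ 2 + κ * b ^ 2)
      = s * (1 - s) / (1 + s - s ^ 2) * (a + b) ^ 2 + s * b ^ 2 := by
    rw [← hcoef, hs]; ring
  rw [e8]
  calc s * (1 - s) / (1 + s - s ^ 2) * (a + b) ^ 2 + s * b ^ 2
      ≤ s * (1 - s) / (1 + s - s ^ 2) * (W ^ 2 * (1 + 2 * p - p ^ 2) ^ 2)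
        + s * (W ^ 2 * (1 - p ^ 2) ^ 2) := by gcongr
    _ = W ^ 2 * ((s * (1 - s) * (1 + 2 * p - p ^ 2) ^ 2
        + s * (1 + s - s ^ 2) * (1 - p ^ 2) ^ 2) / (1 + s - s ^ 2)) := by
        field_simp
    _ ≤ W ^ 2 * 1 := by
        gcongr
        rwa [div_le_one hm]
    _ = θ ^ 2 * R ^ 2 := by rw [hW]; ring

end ScalarInequality

/-! ### Projections onto closed convex sets. -/

section Projection

theorem inner_sub_le_zero_of_isMinimizer {E : Type*} [NormedAddCommGroup E] [InnerProductSpace ℝ E]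
    {S : Set E} (hS : Convex ℝ S) {y p : E} (hp : p ∈ S) (hmin : ∀ w ∈ S, ‖y - p‖ ≤ ‖y - w‖) :
    ∀ w ∈ S, ⟪y - p, w - p⟫_ℝ ≤ 0 := by
  rw [← norm_eq_iInf_iff_real_inner_le_zero hS hp]
  have : Nonempty S := ⟨⟨p, hp⟩⟩
  refine le_antisymm (le_ciInf fun w => hmin w w.2) ?_
  exact ciInf_le ⟨0, by rintro _ ⟨w, rfl⟩; exact norm_nonneg _⟩ (⟨p, hp⟩ : S)

theorem exists_projection {E : Type*} [NormedAddCommGroup E] [InnerProductSpace ℝ E]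
    [CompleteSpace E] {S : Set E} (hne : S.Nonempty) (hcl : IsClosed S) (hS : Convex ℝ S) (y : E) :
    ∃ p ∈ S, ∀ w ∈ S, ‖y - p‖ ≤ ‖y - w‖ := by
  obtain ⟨p, hp, h⟩ := exists_norm_eq_iInf_of_complete_convex hne hcl.isComplete hS y
  refine ⟨p, hp, fun w hw => ?_⟩
  rw [h]
  exact ciInf_le ⟨0, by rintro _ ⟨w, rfl⟩; exact norm_nonneg _⟩ (⟨w, hw⟩ : S)

variable {d : ℕ} {S : Set (Euc d)}

theorem proj_spec (hne : S.Nonempty) (hcl : IsClosed S) (hS : Convex ℝ S) (y : Euc d) :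
    proj S y ∈ S ∧ ∀ w ∈ S, ⟪y - proj S y, w - proj S y⟫_ℝ ≤ 0 := by
  obtain ⟨p, hp⟩ := exists_projection hne hcl hS y
  have h := Classical.epsilon_spec (p := fun p => p ∈ S ∧ ∀ w ∈ S, ‖y - p‖ ≤ ‖y - w‖) ⟨p, hp⟩
  exact ⟨h.1, inner_sub_le_zero_of_isMinimizer hS h.1 h.2⟩

theorem orthant_nonempty (d : ℕ) : (orthant d).Nonempty := ⟨0, fun _ => le_rfl⟩

theorem isClosed_orthant (d : ℕ) : IsClosed (orthant d) := by
  have : orthant d = ⋂ j, {v : Euc d | 0 ≤ v j} := by ext; simp [orthant]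
  rw [this]
  exact isClosed_iInter fun j => isClosed_le continuous_const (by fun_prop)

theorem convex_orthant (d : ℕ) : Convex ℝ (orthant d) := by
  intro v hv w hw a b ha hb _ j
  have := mul_nonneg ha (hv j)
  have := mul_nonneg hb (hw j)
  simp only [PiLp.add_apply, PiLp.smul_apply, smul_eq_mul]
  linarith

end Projection

/-! ### Existence for strongly monotone variational inequalities. -/

section VariationalInequality

variable {E : Type*} [NormedAddCommGroup E] [InnerProductSpace ℝ E]

/-- A strongly monotone Lipschitz variational inequality over a nonempty closed convex set has a
solution. -/
theorem exists_variationalInequality_solution [CompleteSpace E] {S : Set E} (hne : S.Nonempty)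
    (hcl : IsClosed S) (hS : Convex ℝ S) {F : E → E} {μ l : ℝ} (hμ : 0 < μ) (hl : 0 < l)
    (hmono : ∀ x y, μ * ‖x - y‖ ^ 2 ≤ ⟪x - y, F x - F y⟫_ℝ)
    (hlip : ∀ x y, ‖F x - F y‖ ≤ l * ‖x - y‖) :
    ∃ x ∈ S, ∀ y ∈ S, 0 ≤ ⟪F x, y - x⟫_ℝ := by
  choose P hPS hPmin using exists_projection hne hcl hS
  have hP : ∀ y, ∀ w ∈ S, ⟪y - P y, w - P y⟫_ℝ ≤ 0 :=
    fun y => inner_sub_le_zero_of_isMinimizer hS (hPS y) (hPmin y)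
  have hPlip : ∀ y z, ‖P y - P z‖ ≤ ‖y - z‖ := by
    intro y z
    have h1 := hP y _ (hPS z)
    have h2 := hP z _ (hPS y)
    have h3 : ‖P y - P z‖ ^ 2 ≤ ⟪y - z, P y - P z⟫_ℝ := by
      rw [← real_inner_self_eq_norm_sq]
      have e : ⟪y - z, P y - P z⟫_ℝ - ⟪P y - P z, P y - P z⟫_ℝ
          = -(⟪y - P y, P z - P y⟫_ℝ + ⟪z - P z, P y - P z⟫_ℝ) := by
        simp only [inner_sub_left, inner_sub_right]; ring
      linarith
    have h4 := real_inner_le_norm (y - z) (P y - P z)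
    by_contra! hlt
    nlinarith [norm_nonneg (y - z), norm_nonneg (P y - P z)]
  -- This step minimizes the contraction factor 1 - 2γμ + γ²l².
  set γ : ℝ := μ / l ^ 2 with hγ
  have hγ0 : 0 < γ := by positivity
  set q : ℝ := 1 - μ ^ 2 / l ^ 2 with hq
  have hcontr : ∀ x y, ‖(x - γ • F x) - (y - γ • F y)‖ ^ 2 ≤ q * ‖x - y‖ ^ 2 := by
    intro x y
    have e : (x - γ • F x) - (y - γ • F y) = (x - y) - γ • (F x - F y) := by
      rw [smul_sub]; abel
    rw [e, norm_sub_sq_real, norm_smul, inner_smul_right, Real.norm_of_nonneg hγ0.le]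
    have h1 := hmono x y
    have h2 : ‖F x - F y‖ ^ 2 ≤ (l * ‖x - y‖) ^ 2 := pow_le_pow_left₀ (norm_nonneg _) (hlip x y) 2
    have h3 : q = 1 - 2 * γ * μ + γ ^ 2 * l ^ 2 := by
      rw [hq, hγ]; field_simp; ring
    rw [h3]
    nlinarith [mul_le_mul_of_nonneg_left h1 hγ0.le, mul_le_mul_of_nonneg_left h2 (sq_nonneg γ)]
  have hq1 : q < 1 := by
    have : 0 < μ ^ 2 / l ^ 2 := by positivity
    linarith
  -- If q < 0, then `hcontr` forces the space to be trivial, and √q = 0 is still a valid constant.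
  have hK : ContractingWith (Real.toNNReal √q) fun x => P (x - γ • F x) := by
    refine ⟨?_, LipschitzWith.of_dist_le_mul fun x y => ?_⟩
    · rw [Real.toNNReal_lt_one, Real.sqrt_lt' one_pos]; simpa using hq1
    · rw [dist_eq_norm, dist_eq_norm, Real.coe_toNNReal _ (Real.sqrt_nonneg _)]
      refine (hPlip _ _).trans ?_
      calc ‖(x - γ • F x) - (y - γ • F y)‖
          ≤ √(q * ‖x - y‖ ^ 2) := Real.le_sqrt_of_sq_le (hcontr x y)
        _ = √q * ‖x - y‖ := by
          rw [Real.sqrt_mul' _ (sq_nonneg _), Real.sqrt_sq (norm_nonneg _)]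
  have : Nonempty E := ⟨0⟩
  have hfix : P (hK.fixedPoint - γ • F hK.fixedPoint) = hK.fixedPoint := hK.fixedPoint_isFixedPt
  set x := hK.fixedPoint
  refine ⟨x, hfix ▸ hPS _, fun y hy => ?_⟩
  have := hP (x - γ • F x) y hy
  rw [hfix] at this
  have e : x - γ • F x - x = -(γ • F x) := by abel
  rw [e, inner_neg_left, inner_smul_left] at this
  simp only [conj_trivial] at this
  have h5 : 0 ≤ γ * ⟪F x, y - x⟫_ℝ := by linarith
  exact nonneg_of_mul_nonneg_right h5 hγ0

end VariationalInequality

/-! ### Lagrange multipliers for affine constraints under weak Slater. -/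

section Multipliers

variable {E : Type*} [AddCommGroup E] [Module ℝ E]

theorem affine_eval_convexCombo (f : E →ᵃ[ℝ] ℝ) (x y : E) {a b : ℝ} (hab : a + b = 1) :
    f (a • x + b • y) = a * f x + b * f y := by
  have h := Convex.combo_affine_apply (f := f) (x := x) (y := y) hab
  simpa using h

/-- `x₀` lies in the algebraic relative interior of `C`. -/
def IsRelCore (C : Set E) (x₀ : E) : Prop :=
  ∀ y ∈ C, ∃ t : ℝ, 0 < t ∧ x₀ + t • (x₀ - y) ∈ C

theorem affine_extrapolate (f : E →ᵃ[ℝ] ℝ) (x y : E) (t : ℝ) :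
    f (x + t • (x - y)) = f x + t * (f x - f y) := by
  have e : x + t • (x - y) = (1 + t) • x + (-t) • y := by
    rw [smul_sub, add_smul, neg_smul, one_smul]; abel
  rw [e, affine_eval_convexCombo f x y (by ring)]
  ring

/-- An affine function minimized over `C` at a point of the relative core is constant on `C`. -/
theorem IsRelCore.eq_of_isMin {C : Set E} {x₀ : E} (h : IsRelCore C x₀) {f : E →ᵃ[ℝ] ℝ}
    (hmin : ∀ y ∈ C, f x₀ ≤ f y) : ∀ y ∈ C, f y = f x₀ := by
  intro y hy
  obtain ⟨t, ht, hmem⟩ := h y hy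
  have h1 := hmin _ hmem
  rw [affine_extrapolate] at h1
  refine le_antisymm ?_ (hmin y hy)
  have : 0 ≤ t * (f x₀ - f y) := by linarith
  linarith [nonneg_of_mul_nonneg_right this ht]

/-- Separation in the plane: the values of an affine function below and above a hyperplane admit a
common slope. -/
theorem exists_slope {C : Set E} (hC : Convex ℝ C) {f g : E →ᵃ[ℝ] ℝ} {v : ℝ}
    (hf : ∀ y ∈ C, g y = 0 → v ≤ f y) {x₁ x₂ : E} (hx₁ : x₁ ∈ C) (hg₁ : g x₁ < 0)
    (hx₂ : x₂ ∈ C) (hg₂ : 0 < g x₂) : ∃ r : ℝ, ∀ y ∈ C, v ≤ f y + r * g y := by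
  -- The segment from x to y meets g = 0, where f ≥ v; this orders the two slopes.
  have hcross : ∀ x ∈ C, ∀ y ∈ C, g x < 0 → 0 < g y →
      (v - f y) / g y ≤ (v - f x) / g x := by
    intro x hx y hy hgx hgy
    have hd : 0 < g y - g x := by linarith
    have hab : g y / (g y - g x) + -g x / (g y - g x) = 1 := by
      field_simp; ring
    have hmem := hC hx hy (div_nonneg hgy.le hd.le) (div_nonneg (by linarith) hd.le) hab
    have h1 := hf _ hmem (by
      rw [affine_eval_convexCombo g x y hab]; field_simp; ring)
    rw [affine_eval_convexCombo f x y hab] at h1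
    have h2 : v * (g y - g x) ≤ g y * f x - g x * f y := by
      have := mul_le_mul_of_nonneg_right h1 hd.le
      have e : (g y / (g y - g x) * f x + -g x / (g y - g x) * f y) * (g y - g x)
          = g y * f x - g x * f y := by field_simp; ring
      linarith
    have h3 : (v - f x) / g x = (f x - v) / (-g x) := by rw [← neg_sub, neg_div, div_neg]
    rw [h3, div_le_div_iff₀ hgy (by linarith)]
    nlinarith
  set S : Set ℝ := {r | ∃ y ∈ C, 0 < g y ∧ r = (v - f y) / g y} with hS
  have hbdd : BddAbove S := ⟨(v - f x₁) / g x₁, by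
    rintro _ ⟨y, hy, hgy, rfl⟩; exact hcross x₁ hx₁ y hy hg₁ hgy⟩
  have hne : S.Nonempty := ⟨_, x₂, hx₂, hg₂, rfl⟩
  -- The slope must dominate every ratio (v - f)/g with g > 0 and stay below every one with g < 0;
  -- the supremum of the former does both.
  refine ⟨sSup S, fun y hy => ?_⟩
  rcases lt_trichotomy (g y) 0 with h | h | h
  · have : sSup S ≤ (v - f y) / g y := csSup_le hne (by
      rintro _ ⟨w, hw, hgw, rfl⟩; exact hcross y hy w hw h hgw)
    rw [le_div_iff_of_neg h] at this
    linarith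
  · rw [h]; simpa using hf y hy h
  · have : (v - f y) / g y ≤ sSup S := le_csSup hbdd ⟨y, hy, h, rfl⟩
    rw [div_le_iff₀ h] at this
    linarith

/-- Multiplier of one affine inequality under a strict feasibility condition. -/
theorem exists_nonneg_multiplier {C : Set E} (hC : Convex ℝ C) {f g : E →ᵃ[ℝ] ℝ} {v : ℝ}
    (hf : ∀ y ∈ C, g y ≤ 0 → v ≤ f y) {x₁ : E} (hx₁ : x₁ ∈ C) (hg₁ : g x₁ < 0) :
    ∃ r : ℝ, 0 ≤ r ∧ ∀ y ∈ C, v ≤ f y + r * g y := by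
  by_cases h : ∃ x₂ ∈ C, 0 < g x₂
  · obtain ⟨x₂, hx₂, hg₂⟩ := h
    obtain ⟨r, hr⟩ := exists_slope hC (fun y hy h0 => hf y hy h0.le) hx₁ hg₁ hx₂ hg₂
    refine ⟨max r 0, le_max_right _ _, fun y hy => ?_⟩
    rcases le_or_gt (g y) 0 with hy0 | hy0
    · rcases le_total r 0 with hr0 | hr0
      · rw [max_eq_right hr0]; simpa using hf y hy hy0
      · rw [max_eq_left hr0]; exact hr y hy
    · have := mul_le_mul_of_nonneg_right (le_max_left r 0) hy0.le
      linarith [hr y hy]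
  · push Not at h
    exact ⟨0, le_rfl, fun y hy => by simpa using hf y hy (h y hy)⟩

/-- Multiplier of one affine equation that holds at a point of the relative core. -/
theorem exists_multiplier_of_eq {C : Set E} (hC : Convex ℝ C) {f g : E →ᵃ[ℝ] ℝ} {v : ℝ}
    (hf : ∀ y ∈ C, g y = 0 → v ≤ f y) {x₀ : E} (hx₀ : IsRelCore C x₀) (hg₀ : g x₀ = 0) :
    ∃ r : ℝ, ∀ y ∈ C, v ≤ f y + r * g y := by
  by_cases h : ∀ y ∈ C, g y = 0
  · exact ⟨0, fun y hy => by simpa using hf y hy (h y hy)⟩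
  · push Not at h
    obtain ⟨y, hy, hgy⟩ := h
    -- Reflecting y through the core point produces a point of C where g has the opposite sign, as
    -- `exists_slope` requires.
    obtain ⟨t, ht, hmem⟩ := hx₀ y hy
    have e : g (x₀ + t • (x₀ - y)) = -(t * g y) := by rw [affine_extrapolate, hg₀]; ring
    rcases lt_or_gt_of_ne hgy with h1 | h1
    · exact exists_slope hC hf hy h1 hmem (by rw [e]; nlinarith)
    · exact exists_slope hC hf hmem (by rw [e]; nlinarith) hy h1

theorem affine_add_sum_apply {ι : Type*} (f : E →ᵃ[ℝ] ℝ) (g : ι → E →ᵃ[ℝ] ℝ) (s : Finset ι)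
    (r : ι → ℝ) (y : E) :
    (f + ∑ j ∈ s, r j • g j : E →ᵃ[ℝ] ℝ) y = f y + ∑ j ∈ s, r j * g j y := by
  classical
  induction s using Finset.induction_on with
  | empty => simp
  | insert k s hk ih =>
    rw [Finset.sum_insert hk, Finset.sum_insert hk]
    simp only [AffineMap.coe_add, AffineMap.coe_smul, Pi.add_apply, Pi.smul_apply,
      smul_eq_mul] at ih ⊢
    linarith

/-- Lagrange multipliers for finitely many affine inequalities over a convex set, under the weak
Slater condition: a feasible point in the relative core. -/
theorem exists_multipliers {ι : Type*} [DecidableEq ι] (g : ι → E →ᵃ[ℝ] ℝ) (s : Finset ι) :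
    ∀ {C : Set E}, Convex ℝ C → ∀ {x₀ : E}, x₀ ∈ C → IsRelCore C x₀ → (∀ j ∈ s, g j x₀ ≤ 0) →
      ∀ {f : E →ᵃ[ℝ] ℝ} {v : ℝ}, (∀ y ∈ C, (∀ j ∈ s, g j y ≤ 0) → v ≤ f y) →
      ∃ r : ι → ℝ, (∀ j, 0 ≤ r j) ∧ ∀ y ∈ C, v ≤ f y + ∑ j ∈ s, r j * g j y := by
  induction s using Finset.induction_on with
  | empty =>
    intro C _ x₀ _ _ _ f v hf
    exact ⟨0, fun _ => le_rfl, fun y hy => by simpa using hf y hy⟩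
  | insert i s hi ih =>
    intro C hC x₀ hx₀ hcore hfeas f v hf
    have hfeas' : ∀ j ∈ s, g j x₀ ≤ 0 := fun j hj => hfeas j (Finset.mem_insert_of_mem hj)
    have hupd : ∀ (r : ι → ℝ) (a : ℝ) (y : E),
        ∑ j ∈ insert i s, Function.update r i a j * g j y = a * g i y + ∑ j ∈ s, r j * g j y := by
      intro r a y
      rw [Finset.sum_insert hi, Function.update_self]
      congr 1
      refine Finset.sum_congr rfl fun j hj => ?_
      rw [Function.update_of_ne (by rintro rfl; exact hi hj)]
    have hupd0 : ∀ (r : ι → ℝ) (a : ℝ), (∀ j, 0 ≤ r j) → 0 ≤ a →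
        ∀ j, 0 ≤ Function.update r i a j := by
      intro r a hr ha j
      by_cases h : j = i
      · subst h; simpa using ha
      · rw [Function.update_of_ne h]; exact hr j
    -- If constraint i can be strict, it is dualized first over C cut by the others, and induction
    -- treats the rest. If not, it acts as an equation on the feasible set.
    by_cases hstrict : ∃ x₁ ∈ C, (∀ j ∈ s, g j x₁ ≤ 0) ∧ g i x₁ < 0
    · obtain ⟨x₁, hx₁, hx₁s, hx₁i⟩ := hstrict
      have hK : Convex ℝ (C ∩ {y | ∀ j ∈ s, g j y ≤ 0}) := by
        refine hC.inter fun y hy w hw a b ha hb hab j hj => ?_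
        rw [affine_eval_convexCombo _ _ _ hab]
        nlinarith [hy j hj, hw j hj]
      obtain ⟨a, ha, har⟩ := exists_nonneg_multiplier (f := f) (g := g i) (v := v) hK
        (fun y hy hyi => hf y hy.1 (by
          intro j hj
          rcases Finset.mem_insert.1 hj with rfl | hj
          · exact hyi
          · exact hy.2 j hj)) ⟨hx₁, hx₁s⟩ hx₁i
      obtain ⟨r, hr, hrC⟩ := ih hC hx₀ hcore hfeas' (f := f + a • g i) (v := v)
        (fun y hy hys => by simpa using har y ⟨hy, hys⟩)
      refine ⟨Function.update r i a, hupd0 r a hr ha, fun y hy => ?_⟩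
      rw [hupd]
      have := hrC y hy
      simp only [AffineMap.coe_add, AffineMap.coe_smul, Pi.add_apply, Pi.smul_apply,
        smul_eq_mul] at this
      linarith
    · push Not at hstrict
      have hgi0 : g i x₀ = 0 :=
        le_antisymm (hfeas i (Finset.mem_insert_self i s)) (hstrict x₀ hx₀ hfeas')
      obtain ⟨r₁, hr₁, hr₁C⟩ := ih hC hx₀ hcore hfeas' (f := g i) (v := 0) hstrict
      set G : E →ᵃ[ℝ] ℝ := g i + ∑ j ∈ s, r₁ j • g j with hG
      have hGap : ∀ y, G y = g i y + ∑ j ∈ s, r₁ j * g j y := affine_add_sum_apply _ _ _ _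
      have hsum0 : ∑ j ∈ s, r₁ j * g j x₀ ≤ 0 :=
        Finset.sum_nonpos fun j hj => mul_nonpos_of_nonneg_of_nonpos (hr₁ j) (hfeas' j hj)
      have hG0 : G x₀ = 0 := by
        refine le_antisymm ?_ ?_
        · rw [hGap, hgi0]; linarith
        · rw [hGap]; exact hr₁C x₀ hx₀
      -- G is nonnegative on C and vanishes at a core point. Thus on C the constraint `g i` is minus
      -- a nonnegative combination of the others.
      have hconst : ∀ y ∈ C, G y = 0 := fun y hy =>
        (hcore.eq_of_isMin (fun w hw => by rw [hG0, hGap]; exact hr₁C w hw) y hy).trans hG0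
      have hC' : Convex ℝ (C ∩ {y | g i y = 0}) := by
        refine hC.inter fun y hy w hw a b ha hb hab => ?_
        have h1 : g i y = 0 := hy
        have h2 : g i w = 0 := hw
        change g i (a • y + b • w) = 0
        rw [affine_eval_convexCombo _ _ _ hab, h1, h2]; ring
      have hcore' : IsRelCore (C ∩ {y | g i y = 0}) x₀ := by
        rintro y ⟨hy, hyi⟩
        obtain ⟨t, ht, hmem⟩ := hcore y hy
        refine ⟨t, ht, hmem, ?_⟩
        have h1 : g i y = 0 := hyi
        change g i (x₀ + t • (x₀ - y)) = 0
        rw [affine_extrapolate, hgi0, h1]; ring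
      obtain ⟨r₂, hr₂, hr₂C⟩ := ih hC' ⟨hx₀, hgi0⟩ hcore' hfeas' (f := f) (v := v)
        (fun y hy hys => hf y hy.1 (by
          intro j hj
          rcases Finset.mem_insert.1 hj with rfl | hj
          · exact le_of_eq hy.2
          · exact hys j hj))
      obtain ⟨η, hη⟩ := exists_multiplier_of_eq hC (f := f + ∑ j ∈ s, r₂ j • g j) (g := g i)
        (v := v) (fun y hy hyi => by rw [affine_add_sum_apply]; exact hr₂C y ⟨hy, hyi⟩) hcore hgi0
      -- The equation multiplier η has no sign; adding |η| times G, which is zero on C, makes it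
      -- nonnegative at no cost.
      refine ⟨Function.update (r₂ + |η| • r₁) i (η + |η|), hupd0 _ _ ?_ ?_, fun y hy => ?_⟩
      · intro j
        simpa using add_nonneg (hr₂ j) (mul_nonneg (abs_nonneg η) (hr₁ j))
      · linarith [neg_abs_le η]
      · rw [hupd]
        have h1 := hη y hy
        rw [affine_add_sum_apply] at h1
        have h2 := hconst y hy
        rw [hGap] at h2
        have h3 : ∑ j ∈ s, (r₂ + |η| • r₁) j * g j y
            = ∑ j ∈ s, r₂ j * g j y + |η| * ∑ j ∈ s, r₁ j * g j y := by
          rw [Finset.mul_sum, ← Finset.sum_add_distrib]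
          refine Finset.sum_congr rfl fun j _ => ?_
          simp only [Pi.add_apply, Pi.smul_apply, smul_eq_mul]; ring
        rw [h3]
        have h4 : |η| * ∑ j ∈ s, r₁ j * g j y = -(|η| * g i y) := by
          linear_combination |η| * h2
        rw [h4]
        linarith

end Multipliers

/-- The line through y and x₀ stays in the affine span, where x₀ is interior. Holding for all small
t > 0, not just one, lets finitely many blocks share the same t. -/
theorem eventually_extrapolate_mem_of_mem_intrinsicInterior {E : Type*}
    [NormedAddCommGroup E] [NormedSpace ℝ E] {C : Set E} {x₀ : E}
    (h : x₀ ∈ intrinsicInterior ℝ C) {y : E} (hy : y ∈ C) :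
    ∀ᶠ t in nhdsWithin (0 : ℝ) (Set.Ioi 0), x₀ + t • (x₀ - y) ∈ C := by
  obtain ⟨p, hp, rfl⟩ := mem_intrinsicInterior.1 h
  have hline : ∀ t : ℝ, (p : E) + t • ((p : E) - y) ∈ affineSpan ℝ C := by
    intro t
    have := AffineMap.lineMap_mem (1 + t) (subset_affineSpan ℝ C hy) p.2
    rw [AffineMap.lineMap_apply_module'] at this
    convert this using 1
    rw [add_smul, one_smul]; abel
  let φ : ℝ → affineSpan ℝ C := fun t => ⟨(p : E) + t • ((p : E) - y), hline t⟩
  have hφ : Continuous φ := Continuous.subtype_mk (by fun_prop) _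
  have hφ0 : φ 0 = p := by ext; simp [φ]
  have hev : ∀ᶠ t in nhds (0 : ℝ), φ t ∈ interior ((↑) ⁻¹' C : Set (affineSpan ℝ C)) :=
    hφ.continuousAt.eventually_mem (by rw [hφ0]; exact isOpen_interior.mem_nhds hp)
  refine (hev.filter_mono nhdsWithin_le_nhds).mono fun t ht => ?_
  have h : φ t ∈ ((↑) ⁻¹' C : Set (affineSpan ℝ C)) := interior_subset ht
  exact h

/-! ### Quadratic forms of symmetric matrices through eigenbases. -/

section Spectral

variable {p : ℕ} {M : Matrix (Fin p) (Fin p) ℝ}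

theorem isSymmetric_toEuclideanLin (hM : M.IsHermitian) (v w : Euc p) :
    ⟪Matrix.toEuclideanLin M v, w⟫_ℝ = ⟪v, Matrix.toEuclideanLin M w⟫_ℝ :=
  Matrix.isSymmetric_toEuclideanLin_iff.mpr hM v w

theorem toEuclideanLin_eigenvectorBasis (hM : M.IsHermitian) (j : Fin p) :
    Matrix.toEuclideanLin M (hM.eigenvectorBasis j) = hM.eigenvalues j • hM.eigenvectorBasis j := by
  ext i
  have := congrFun (hM.mulVec_eigenvectorBasis j) i
  simpa [Matrix.toLpLin_apply] using this

theorem inner_eigenvectorBasis_apply (hM : M.IsHermitian) (j : Fin p) (v : Euc p) :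
    ⟪hM.eigenvectorBasis j, Matrix.toEuclideanLin M v⟫_ℝ
      = hM.eigenvalues j * ⟪hM.eigenvectorBasis j, v⟫_ℝ := by
  rw [← isSymmetric_toEuclideanLin hM, toEuclideanLin_eigenvectorBasis, real_inner_smul_left]

theorem norm_sq_eq_sum_eigen (hM : M.IsHermitian) (v : Euc p) :
    ‖v‖ ^ 2 = ∑ j, ⟪hM.eigenvectorBasis j, v⟫_ℝ ^ 2 := by
  rw [← real_inner_self_eq_norm_sq, ← hM.eigenvectorBasis.sum_inner_mul_inner v v]
  refine Finset.sum_congr rfl fun j _ => ?_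
  rw [real_inner_comm, sq]

theorem inner_apply_eq_sum_eigen (hM : M.IsHermitian) (v : Euc p) :
    ⟪Matrix.toEuclideanLin M v, v⟫_ℝ
      = ∑ j, hM.eigenvalues j * ⟪hM.eigenvectorBasis j, v⟫_ℝ ^ 2 := by
  rw [← hM.eigenvectorBasis.sum_inner_mul_inner]
  refine Finset.sum_congr rfl fun j _ => ?_
  rw [real_inner_comm, inner_eigenvectorBasis_apply]
  ring

theorem norm_apply_sq_eq_sum_eigen (hM : M.IsHermitian) (v : Euc p) :
    ‖Matrix.toEuclideanLin M v‖ ^ 2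
      = ∑ j, hM.eigenvalues j ^ 2 * ⟪hM.eigenvectorBasis j, v⟫_ℝ ^ 2 := by
  rw [norm_sq_eq_sum_eigen hM]
  refine Finset.sum_congr rfl fun j _ => ?_
  rw [inner_eigenvectorBasis_apply, mul_pow]

theorem eigAsc_zero_le (hM : M.IsHermitian) (hp : 0 < p) (j : Fin p) :
    eigAsc M hM ⟨0, hp⟩ ≤ hM.eigenvalues j := by
  refine hM.eigenvalues₀_antitone ?_
  rw [Fin.le_def]
  have := ((Fintype.equivOfCardEq (Fintype.card_fin (Fintype.card (Fin p)))).symm j).2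
  simp only [Fintype.card_fin] at this
  simp only [Fin.val_cast, Fin.val_rev]
  omega

theorem le_eigAsc_last (hM : M.IsHermitian) (hp : p - 1 < p) (j : Fin p) :
    hM.eigenvalues j ≤ eigAsc M hM ⟨p - 1, hp⟩ := by
  refine hM.eigenvalues₀_antitone ?_
  rw [Fin.le_def]
  simp only [Fin.val_cast, Fin.val_rev]
  omega

theorem exists_eigAsc_one_le (hM : M.IsHermitian) (hp : 1 < p) :
    ∃ j₀ : Fin p, ∀ j, j ≠ j₀ → eigAsc M hM ⟨1, hp⟩ ≤ hM.eigenvalues j := by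
  set e := Fintype.equivOfCardEq (α := Fin (Fintype.card (Fin p))) (β := Fin p)
    (Fintype.card_fin _) with he
  -- The list `eigenvalues₀` decreases, so position p - 1 carries the smallest eigenvalue; every
  -- other one is at least the second smallest.
  refine ⟨e ⟨p - 1, by simp only [Fintype.card_fin]; omega⟩, fun j hj => ?_⟩
  refine hM.eigenvalues₀_antitone ?_
  rw [Fin.le_def]
  have h1 := (e.symm j).2
  have h2 : (e.symm j).1 ≠ p - 1 := by
    intro h
    apply hj
    rw [← e.symm_apply_eq]
    exact Fin.ext h
  simp only [Fintype.card_fin] at h1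
  simp only [Fin.val_cast, Fin.val_rev]
  change (e.symm j).1 ≤ _
  omega

theorem eigAsc_zero_mul_norm_sq_le (hM : M.IsHermitian) (hp : 0 < p) (v : Euc p) :
    eigAsc M hM ⟨0, hp⟩ * ‖v‖ ^ 2 ≤ ⟪Matrix.toEuclideanLin M v, v⟫_ℝ := by
  rw [inner_apply_eq_sum_eigen hM, norm_sq_eq_sum_eigen hM, Finset.mul_sum]
  exact Finset.sum_le_sum fun j _ =>
    mul_le_mul_of_nonneg_right (eigAsc_zero_le hM hp j) (sq_nonneg _)

/-- Cocoercivity of a positive semidefinite matrix: eigenvalue by eigenvalue, λ² ≤ λ_max λ. -/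
theorem norm_apply_sq_le_eigAsc_last (hM : M.PosSemidef) (hp : p - 1 < p) (v : Euc p) :
    ‖Matrix.toEuclideanLin M v‖ ^ 2
      ≤ eigAsc M hM.isHermitian ⟨p - 1, hp⟩ * ⟪Matrix.toEuclideanLin M v, v⟫_ℝ := by
  rw [inner_apply_eq_sum_eigen hM.isHermitian, norm_apply_sq_eq_sum_eigen hM.isHermitian,
    Finset.mul_sum]
  refine Finset.sum_le_sum fun j _ => ?_
  rw [← mul_assoc]
  refine mul_le_mul_of_nonneg_right ?_ (sq_nonneg _)
  rw [sq]
  exact mul_le_mul_of_nonneg_right (le_eigAsc_last hM.isHermitian hp j) (hM.eigenvalues_nonneg j)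

/-- The second smallest eigenvalue bounds the quadratic form on the orthogonal complement of a
kernel vector. -/
theorem eigAsc_one_mul_norm_sq_le (hM : M.IsHermitian) (hp : 1 < p)
    (hpos : 0 < eigAsc M hM ⟨1, hp⟩) {o v : Euc p} (ho : o ≠ 0)
    (hMo : Matrix.toEuclideanLin M o = 0) (hov : ⟪o, v⟫_ℝ = 0) :
    eigAsc M hM ⟨1, hp⟩ * ‖v‖ ^ 2 ≤ ⟪Matrix.toEuclideanLin M v, v⟫_ℝ := by
  obtain ⟨j₀, hj₀⟩ := exists_eigAsc_one_le hM hp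
  -- All eigenvalues except the one at j₀ are positive, so the kernel vector is parallel to the
  -- eigenvector of j₀, and v is orthogonal to that eigenvector.
  have horth : ∀ j, j ≠ j₀ → ⟪hM.eigenvectorBasis j, o⟫_ℝ = 0 := by
    intro j hj
    have h := inner_eigenvectorBasis_apply hM j o
    rw [hMo, inner_zero_right] at h
    exact (mul_eq_zero.1 h.symm).resolve_left (hpos.trans_le (hj₀ j hj)).ne'
  have hoj₀ : ⟪hM.eigenvectorBasis j₀, o⟫_ℝ ≠ 0 := by
    intro h0
    apply ho
    have : ‖o‖ ^ 2 = 0 := by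
      rw [norm_sq_eq_sum_eigen hM]
      refine Finset.sum_eq_zero fun j _ => ?_
      by_cases hj : j = j₀
      · rw [hj, h0]; ring
      · rw [horth j hj]; ring
    simpa using this
  have hvj₀ : ⟪hM.eigenvectorBasis j₀, v⟫_ℝ = 0 := by
    rw [← hM.eigenvectorBasis.sum_inner_mul_inner, Finset.sum_eq_single j₀] at hov
    · rw [real_inner_comm] at hov
      exact (mul_eq_zero.1 hov).resolve_left hoj₀
    · intro j _ hj
      rw [real_inner_comm, horth j hj, zero_mul]
    · simp
  rw [inner_apply_eq_sum_eigen hM, norm_sq_eq_sum_eigen hM, Finset.mul_sum]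
  refine Finset.sum_le_sum fun j _ => ?_
  by_cases hj : j = j₀
  · rw [hj, hvj₀]; simp
  · exact mul_le_mul_of_nonneg_right (hj₀ j hj) (sq_nonneg _)

end Spectral

/-! ### The 2 × 2 matrix that balances primal error against disagreement. -/

section Balance

/-- Rayleigh bound at (X, U); X will be the primal error and U the disagreement of the estimates. -/
theorem muTilde_mul_le (a l e X U : ℝ) :
    muTilde a l e * (X ^ 2 + U ^ 2) ≤ a * X ^ 2 - l * U * X + e * U ^ 2 := by
  have h := eigAsc_zero_mul_norm_sq_le (isHermitian_balance a l e) two_pos !₂[X, U]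
  have h1 : ‖(!₂[X, U] : Euc 2)‖ ^ 2 = X ^ 2 + U ^ 2 := by
    rw [EuclideanSpace.norm_sq_eq]; simp
  rw [h1] at h
  refine h.trans_eq ?_
  simp [Matrix.toLpLin_apply, PiLp.inner_apply, Fin.sum_univ_two]
  ring

/-- Completing the square in the first variable leaves the Schur complement e - l²/(4a), whose
positivity is the gain condition. -/
theorem muTilde_pos {a l e : ℝ} (ha : 0 < a) (hl : l ^ 2 / (4 * a) < e) : 0 < muTilde a l e := by
  have hdet : l ^ 2 < 4 * a * e := by
    rw [div_lt_iff₀ (by linarith)] at hl; linarith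
  have hM := isHermitian_balance a l e
  obtain ⟨j, hj⟩ : ∃ j, muTilde a l e = hM.eigenvalues j :=
    ⟨Fintype.equivOfCardEq (Fintype.card_fin _) (Fin.cast (Fintype.card_fin 2).symm (Fin.rev 0)), by
      simp [muTilde, eigAsc, Matrix.IsHermitian.eigenvalues]⟩
  rw [hj]
  refine Matrix.PosDef.eigenvalues_pos ?_ j
  refine Matrix.PosDef.of_dotProduct_mulVec_pos hM fun x hx => ?_
  have hx' : x 0 ≠ 0 ∨ x 1 ≠ 0 := by
    by_contra! h
    exact hx (by ext i; fin_cases i <;> simp [h.1, h.2])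
  have e1 : dotProduct (star x) (Matrix.mulVec !![a, -l / 2; -l / 2, e] x)
      = a * (x 0 - l / (2 * a) * x 1) ^ 2 + (e - l ^ 2 / (4 * a)) * x 1 ^ 2 := by
    simp [Matrix.mulVec, dotProduct, Fin.sum_univ_two]
    field_simp
    ring
  rw [e1]
  have hd : 0 < e - l ^ 2 / (4 * a) := by linarith
  by_cases h1 : x 1 = 0
  · have h0 := hx'.resolve_right (by simpa using h1)
    rw [h1]
    have := mul_pos ha (pow_pos (abs_pos.2 h0) 2)
    rw [sq_abs] at this
    simpa using this
  · have := mul_pos hd (pow_pos (abs_pos.2 h1) 2)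
    rw [sq_abs] at this
    have h2 := mul_nonneg ha.le (sq_nonneg (x 0 - l / (2 * a) * x 1))
    linarith

end Balance

/-! ### The Laplacian on stacked vectors. -/

section Laplacian

variable {N d : ℕ}

/-- The profile all of whose blocks equal `y`. -/
def consensus (N : ℕ) {d : ℕ} (y : Euc d) : Profile N d := WithLp.toLp 2 fun _ => y

@[simp] theorem consensus_apply (y : Euc d) (i : Fin N) : consensus N y i = y := rfl

/-- The Laplacian acting on stacked vectors. -/
def lap (G : SimpleGraph (Fin N)) [DecidableRel G.Adj] (d : ℕ) : Profile N d →ₗ[ℝ] Profile N d where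
  toFun w := WithLp.toLp 2 fun i => disagreement G w i
  map_add' v w := by
    ext i : 1
    simp only [disagreement, PiLp.add_apply, ← Finset.sum_add_distrib]
    exact Finset.sum_congr rfl fun j _ => by abel
  map_smul' a w := by
    ext i l
    simp only [disagreement, PiLp.smul_apply, ← Finset.smul_sum, ← smul_sub, RingHom.id_apply]

/-- The vector of `l`-th coordinates of the blocks of a profile. -/
def coordVec (w : Profile N d) (l : Fin d) : Euc N := WithLp.toLp 2 fun i => w i l

theorem inner_eq_sum_coordVec (v w : Profile N d) :
    ⟪v, w⟫_ℝ = ∑ l, ⟪coordVec v l, coordVec w l⟫_ℝ := by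
  simp only [PiLp.inner_apply, coordVec]
  exact Finset.sum_comm

theorem norm_sq_eq_sum_coordVec (w : Profile N d) : ‖w‖ ^ 2 = ∑ l, ‖coordVec w l‖ ^ 2 := by
  simp only [← real_inner_self_eq_norm_sq]
  exact inner_eq_sum_coordVec w w

variable (G : SimpleGraph (Fin N)) [DecidableRel G.Adj]

theorem lap_apply (w : Profile N d) (i : Fin N) : lap G d w i = disagreement G w i := rfl

/-- The stacked Laplacian is L ⊗ I, so spectral bounds can be proved one coordinate slice at a time.
-/
theorem coordVec_lap (w : Profile N d) (l : Fin d) :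
    coordVec (lap G d w) l = Matrix.toEuclideanLin (G.lapMatrix ℝ) (coordVec w l) := by
  ext i
  simp [coordVec, lap_apply, disagreement, Matrix.toLpLin_apply,
    SimpleGraph.lapMatrix_mulVec_apply]

theorem lap_symm (v w : Profile N d) : ⟪lap G d v, w⟫_ℝ = ⟪v, lap G d w⟫_ℝ := by
  rw [inner_eq_sum_coordVec, inner_eq_sum_coordVec]
  refine Finset.sum_congr rfl fun l _ => ?_
  rw [coordVec_lap, coordVec_lap, isSymmetric_toEuclideanLin (G.isHermitian_lapMatrix ℝ)]

@[simp] theorem lap_consensus (y : Euc d) : lap G d (consensus N y) = 0 := by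
  ext i l
  simp [lap_apply, disagreement]

theorem sum_lap (w : Profile N d) : ∑ i, lap G d w i = 0 := by
  ext l
  have h := lap_symm G w (consensus N (EuclideanSpace.single l 1))
  rw [lap_consensus, inner_zero_right, PiLp.inner_apply] at h
  simpa [EuclideanSpace.inner_single_right] using h

theorem norm_lap_sq_le (hN : 2 ≤ N) (w : Profile N d) :
    ‖lap G d w‖ ^ 2 ≤ lambdaMax hN G * ⟪lap G d w, w⟫_ℝ := by
  rw [norm_sq_eq_sum_coordVec, inner_eq_sum_coordVec, Finset.mul_sum]
  refine Finset.sum_le_sum fun l _ => ?_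
  rw [coordVec_lap]
  exact norm_apply_sq_le_eigAsc_last (G.posSemidef_lapMatrix ℝ) (by omega) _

theorem sum_eq_smul_avg (hN : 2 ≤ N) (w : Profile N d) : ∑ i, w i = (N : ℝ) • w.avg := by
  have : (N : ℝ) ≠ 0 := by positivity
  rw [Profile.avg, smul_smul, mul_one_div_cancel this, one_smul]

theorem sum_sub_consensus_avg (hN : 2 ≤ N) (w : Profile N d) :
    ∑ i, (w - consensus N w.avg) i = 0 := by
  simp [sum_eq_smul_avg hN, ← Nat.cast_smul_eq_nsmul ℝ]

theorem inner_consensus (y : Euc d) (w : Profile N d) :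
    ⟪consensus N y, w⟫_ℝ = ⟪y, ∑ i, w i⟫_ℝ := by
  simp [PiLp.inner_apply, inner_sum]

/-- Removing the average changes neither side's Laplacian form and makes each slice orthogonal to
the all-ones kernel vector. -/
theorem lambdaTwo_mul_norm_sq_le (hN : 2 ≤ N) (hpos : 0 < lambdaTwo hN G) (w : Profile N d) :
    lambdaTwo hN G * ‖w - consensus N w.avg‖ ^ 2 ≤ ⟪lap G d w, w⟫_ℝ := by
  set v := w - consensus N w.avg with hv
  have hsum : ∑ i, v i = 0 := sum_sub_consensus_avg hN w
  have hlap : lap G d w = lap G d v := by rw [hv, map_sub, lap_consensus, sub_zero]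
  have hin : ⟪lap G d w, w⟫_ℝ = ⟪lap G d v, v⟫_ℝ := by
    rw [hlap, hv, inner_sub_right, lap_symm _ _ (consensus N w.avg), lap_consensus,
      inner_zero_right, sub_zero]
  rw [hin, norm_sq_eq_sum_coordVec, inner_eq_sum_coordVec, Finset.mul_sum]
  refine Finset.sum_le_sum fun l _ => ?_
  rw [coordVec_lap]
  refine eigAsc_one_mul_norm_sq_le (G.isHermitian_lapMatrix ℝ) (by omega) hpos
    (o := WithLp.toLp 2 fun _ => 1) ?_ ?_ ?_
  · intro h
    have := congrArg (fun z : Euc N => z ⟨0, by omega⟩) h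
    simp at this
  · ext i
    have := congrFun (G.lapMatrix_mulVec_const_eq_zero (R := ℝ)) i
    simpa [Matrix.toLpLin_apply] using this
  · have := congrArg (fun z : Euc d => z l) hsum
    simpa [PiLp.inner_apply, coordVec] using this

theorem lambdaTwo_le_lambdaMax (hN : 2 ≤ N) : lambdaTwo hN G ≤ lambdaMax hN G := by
  refine (G.posSemidef_lapMatrix ℝ).isHermitian.eigenvalues₀_antitone ?_
  rw [Fin.le_def]
  simp only [Fin.val_cast, Fin.val_rev]
  omega

theorem norm_lap_le (hN : 2 ≤ N) (hmax : 0 ≤ lambdaMax hN G) (w : Profile N d) :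
    ‖lap G d w‖ ≤ lambdaMax hN G * ‖w - consensus N w.avg‖ := by
  have hlap : lap G d w = lap G d (w - consensus N w.avg) := by
    rw [map_sub, lap_consensus, sub_zero]
  rw [hlap]
  set v := w - consensus N w.avg
  have h1 := norm_lap_sq_le G hN v
  have h2 := real_inner_le_norm (lap G d v) v
  rcases (norm_nonneg (lap G d v)).eq_or_lt with h0 | h0
  · rw [← h0]
    exact mul_nonneg hmax (norm_nonneg _)
  · have h5 : ‖lap G d v‖ * ‖lap G d v‖ ≤ (lambdaMax hN G * ‖v‖) * ‖lap G d v‖ := by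
      nlinarith [mul_le_mul_of_nonneg_left h2 hmax]
    exact le_of_mul_le_mul_right h5 h0

theorem eq_consensus_of_lap_eq_zero (hN : 2 ≤ N) (hpos : 0 < lambdaTwo hN G) {w : Profile N d}
    (h : lap G d w = 0) : w = consensus N w.avg := by
  have h1 := lambdaTwo_mul_norm_sq_le G hN hpos w
  rw [h, inner_zero_left] at h1
  have h2 : ‖w - consensus N w.avg‖ ^ 2 ≤ 0 := nonpos_of_mul_nonpos_right h1 hpos
  have h3 : ‖w - consensus N w.avg‖ = 0 := by nlinarith [norm_nonneg (w - consensus N w.avg)]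
  exact sub_eq_zero.1 (norm_eq_zero.1 h3)

/-- By self-adjointness the range is the orthogonal complement of the kernel, and the kernel
consists of consensus profiles. -/
theorem exists_lap_eq (hN : 2 ≤ N) (hpos : 0 < lambdaTwo hN G) {y : Profile N d}
    (hy : ∑ i, y i = 0) : ∃ z, lap G d z = y := by
  have hadj : LinearMap.adjoint (lap G d) = lap G d :=
    ((LinearMap.eq_adjoint_iff _ _).2 (lap_symm G)).symm
  have hmem : y ∈ (LinearMap.ker (lap G d))ᗮ := by
    rw [Submodule.mem_orthogonal]
    intro w hw
    rw [eq_consensus_of_lap_eq_zero G hN hpos (LinearMap.mem_ker.1 hw), inner_consensus, hy,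
      inner_zero_right]
  rw [LinearMap.orthogonal_ker, hadj] at hmem
  exact hmem

end Laplacian

/-! ### Gradient inequality, transposes and one-block deviations. -/

theorem ConvexOn.add_inner_gradient_le {E : Type*} [NormedAddCommGroup E] [InnerProductSpace ℝ E]
    [CompleteSpace E] {f : E → ℝ} (hf : ConvexOn ℝ Set.univ f) {x : E}
    (hd : DifferentiableAt ℝ f x) (y : E) : f x + ⟪gradient f x, y - x⟫_ℝ ≤ f y := by
  have hline : HasDerivAt (fun t : ℝ => x + t • (y - x)) (y - x) 0 := by
    simpa using ((hasDerivAt_id (0 : ℝ)).smul_const (y - x)).const_add x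
  have hd' : HasFDerivAt f (fderiv ℝ f x) (x + (0 : ℝ) • (y - x)) := by
    simpa using hd.hasFDerivAt
  have hder := hd'.comp_hasDerivAt (0 : ℝ) hline
  have hconv : ConvexOn ℝ Set.univ (f ∘ fun t : ℝ => x + t • (y - x)) := by
    have h := hf.comp_affineMap (AffineMap.lineMap x y : ℝ →ᵃ[ℝ] E)
    have e : ((AffineMap.lineMap x y : ℝ →ᵃ[ℝ] E) : ℝ → E) = fun t => x + t • (y - x) := by
      ext t
      rw [AffineMap.lineMap_apply_module', add_comm]
    rwa [Set.preimage_univ, e] at h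
  have h := hconv.le_slope_of_hasDerivAt (Set.mem_univ 0) (Set.mem_univ 1) one_pos hder
  rw [slope_def_field] at h
  rw [inner_gradient_left, map_sub]
  simp at h
  linarith

theorem inner_toEuclideanLin_transpose {m n : ℕ} (A : Matrix (Fin m) (Fin n) ℝ) (l : Euc m)
    (x : Euc n) :
    ⟪Matrix.toEuclideanLin A.transpose l, x⟫_ℝ = ⟪l, Matrix.toEuclideanLin A x⟫_ℝ := by
  have h : A.transpose = A.conjTranspose := by ext; simp
  rw [h, Matrix.toEuclideanLin_conjTranspose_eq_adjoint, LinearMap.adjoint_inner_left]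

section Replace

variable {N n : ℕ} (x : Profile N n) (i : Fin N) (z : Euc n)

theorem replace_apply_self : x.replace i z i = z := by simp [Profile.replace]

theorem replace_apply_of_ne {j : Fin N} (h : j ≠ i) : x.replace i z j = x j := by
  simp [Profile.replace, h]

theorem replace_self : x.replace i (x i) = x := by
  ext1 j
  by_cases h : j = i
  · subst h; rw [replace_apply_self]
  · rw [replace_apply_of_ne _ _ _ h]

theorem avg_replace : (x.replace i z).avg = x.avg + (1 / (N : ℝ)) • (z - x i) := by
  rw [Profile.avg, Profile.avg, ← smul_add]
  congr 1
  rw [← Finset.add_sum_erase _ _ (Finset.mem_univ i),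
    ← Finset.add_sum_erase _ (fun j => x j) (Finset.mem_univ i), replace_apply_self]
  have : ∑ j ∈ Finset.univ.erase i, x.replace i z j = ∑ j ∈ Finset.univ.erase i, x j :=
    Finset.sum_congr rfl fun j hj => replace_apply_of_ne _ _ _ (Finset.ne_of_mem_erase hj)
  rw [this]
  abel

theorem inner_replace_sub (w : Profile N n) :
    ⟪w, x.replace i z - x⟫_ℝ = ⟪w i, z - x i⟫_ℝ := by
  rw [PiLp.inner_apply, Finset.sum_eq_single i]
  · rw [PiLp.sub_apply, replace_apply_self]
  · intro j _ hj
    rw [PiLp.sub_apply, replace_apply_of_ne _ _ _ hj, sub_self, inner_zero_right]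
  · simp

end Replace

/-! ### Variational equilibria and their KKT multipliers. -/

namespace AggGame

variable {N n m : ℕ} (g : AggGame N n m)

/-- The coupling map `x ↦ ∑ i, A_i x_i`. -/
def coupling : Profile N n →ₗ[ℝ] Euc m where
  toFun x := ∑ i, Matrix.toEuclideanLin (g.A i) (x i)
  map_add' x y := by simp [Finset.sum_add_distrib]
  map_smul' a x := by simp [Finset.smul_sum]

theorem residual_eq (x : Profile N n) : g.residual x = g.coupling x - ∑ i, g.b i := rfl

/-- The `j`-th coupling constraint as an affine function. -/
def constraint (j : Fin m) : Profile N n →ᵃ[ℝ] ℝ :=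
  ((EuclideanSpace.proj j : Euc m →L[ℝ] ℝ).toLinearMap ∘ₗ g.coupling).toAffineMap
    - AffineMap.const ℝ _ ((∑ i, g.b i : Euc m) j)

theorem constraint_apply (j : Fin m) (x : Profile N n) : g.constraint j x = g.residual x j := by
  simp [constraint, residual_eq]

/-- The product of the private sets. -/
def box : Set (Profile N n) := {x | ∀ i, x i ∈ g.Ω i}

/-- A deviation of player i from x_i to z moves the average by (z - x_i)/N, exactly the correction
built into `partialGrad`. -/
theorem extPseudoGrad_consensus (x : Profile N n) :
    g.extPseudoGrad x (consensus N x.avg) = g.pseudoGrad x := by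
  ext1 i
  simp only [extPseudoGrad, pseudoGrad, partialGrad, consensus_apply, Jbar, avg_replace,
    replace_apply_self]

variable {g}

theorem Regular.convex_box (hg : g.Regular) : Convex ℝ g.box :=
  fun _ hx _ hy _ _ ha hb hab i => hg.convex i (hx i) (hy i) ha hb hab

theorem Regular.isClosed_box (hg : g.Regular) : IsClosed g.box := by
  have : g.box = ⋂ i, (fun x : Profile N n => x i) ⁻¹' g.Ω i := by ext; simp [box]
  rw [this]
  exact isClosed_iInter fun i => (hg.isCompact i).isClosed.preimage
    (PiLp.continuous_apply 2 _ i)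

theorem Regular.convex_K (hg : g.Regular) : Convex ℝ g.K := by
  intro x hx y hy a b ha hb hab
  refine ⟨hg.convex_box hx.1 hy.1 ha hb hab, fun j => ?_⟩
  rw [← constraint_apply, affine_eval_convexCombo _ _ _ hab, constraint_apply, constraint_apply]
  nlinarith [hx.2 j, hy.2 j]

theorem continuous_residual : Continuous g.residual := by
  refine Continuous.sub (continuous_finsetSum _ fun i _ => ?_) continuous_const
  exact (LinearMap.continuous_of_finiteDimensional (Matrix.toEuclideanLin (g.A i))).comp
    (PiLp.continuous_apply 2 _ i)

theorem Regular.isClosed_K (hg : g.Regular) : IsClosed g.K := by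
  have : g.K = g.box ∩ ⋂ j, {x | g.residual x j ≤ 0} := by ext; simp [K, box]
  rw [this]
  have h := g.continuous_residual
  exact hg.isClosed_box.inter (isClosed_iInter fun j => isClosed_le (by fun_prop) continuous_const)

/-- The variational inequality tested on a one-block deviation is the first-order condition of
player i, sufficient by convexity. -/
theorem Regular.isGNE_of_isVariationalGNE (hg : g.Regular) {x : Profile N n}
    (hx : g.IsVariationalGNE x) : g.IsGNE x := by
  refine ⟨hx.1, fun i z hz => ?_⟩
  have h1 := hx.2 _ hz
  rw [inner_replace_sub] at h1
  have h2 := (hg.convexOn i x).add_inner_gradient_le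
    ((hg.contDiff i x).differentiable one_ne_zero).differentiableAt (x := x i) z
  rw [replace_self] at h2
  change g.Jbar i x + ⟪g.pseudoGrad x i, z - x i⟫_ℝ ≤ _ at h2
  linarith

theorem Regular.exists_isVariationalGNE (hg : g.Regular) {μ l : ℝ} (hμ : 0 < μ) (hl : 0 < l)
    (hmono : ∀ x y : Profile N n,
      μ * ‖x - y‖ ^ 2 ≤ ⟪x - y, g.pseudoGrad x - g.pseudoGrad y⟫_ℝ)
    (hlip : ∀ x y : Profile N n, ‖g.pseudoGrad x - g.pseudoGrad y‖ ≤ l * ‖x - y‖) :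
    ∃ x, g.IsVariationalGNE x := by
  obtain ⟨x₀, hx₀, _⟩ := hg.slater
  exact exists_variationalInequality_solution ⟨x₀, hx₀⟩ hg.isClosed_K hg.convex_K hμ hl hmono hlip

theorem IsVariationalGNE.eq {μ : ℝ} (hμ : 0 < μ)
    (hmono : ∀ x y : Profile N n,
      μ * ‖x - y‖ ^ 2 ≤ ⟪x - y, g.pseudoGrad x - g.pseudoGrad y⟫_ℝ)
    {x y : Profile N n} (hx : g.IsVariationalGNE x) (hy : g.IsVariationalGNE y) : x = y := by
  have h1 := hx.2 y hy.1
  have h2 := hy.2 x hx.1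
  have h3 := hmono x y
  have h4 : ⟪x - y, g.pseudoGrad x - g.pseudoGrad y⟫_ℝ
      = -(⟪g.pseudoGrad x, y - x⟫_ℝ + ⟪g.pseudoGrad y, x - y⟫_ℝ) := by
    rw [real_inner_comm, inner_sub_left, ← neg_sub x y, inner_neg_right]; ring
  have h5 : ‖x - y‖ ^ 2 ≤ 0 := nonpos_of_mul_nonpos_right (by linarith : μ * _ ≤ 0) hμ
  have h6 : ‖x - y‖ = 0 := by nlinarith [norm_nonneg (x - y)]
  exact sub_eq_zero.1 (norm_eq_zero.1 h6)

/-- The variational inequality says that x minimizes the linear function ⟪F(x), ·⟫ over K, so affine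
Lagrange duality over the box applies. -/
theorem Regular.exists_isKKT (hg : g.Regular) {x : Profile N n} (hx : g.IsVariationalGNE x) :
    ∃ l, g.IsKKT x l := by
  obtain ⟨x₀, hx₀, hri⟩ := hg.slater
  have hcore : IsRelCore g.box x₀ := by
    intro y hy
    have h : ∀ᶠ t in nhdsWithin (0 : ℝ) (Set.Ioi 0), ∀ i, x₀ i + t • (x₀ i - y i) ∈ g.Ω i :=
      Filter.eventually_all.2 fun i =>
        eventually_extrapolate_mem_of_mem_intrinsicInterior (hri i) (hy i)
    obtain ⟨t, ht, ht0⟩ := (h.and self_mem_nhdsWithin).exists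
    exact ⟨t, ht0, fun i => ht i⟩
  obtain ⟨r, hr0, hr⟩ := exists_multipliers g.constraint Finset.univ hg.convex_box hx₀.1 hcore
    (fun j _ => by rw [constraint_apply]; exact hx₀.2 j)
    (f := ((innerSL ℝ (g.pseudoGrad x)).toLinearMap).toAffineMap)
    (v := ⟪g.pseudoGrad x, x⟫_ℝ) (by
      intro y hy hyc
      have h := hx.2 y ⟨hy, fun j => by rw [← constraint_apply]; exact hyc j (Finset.mem_univ j)⟩
      rw [inner_sub_right] at h
      simpa using h)
  have hr' : ∀ y ∈ g.box, ⟪g.pseudoGrad x, x⟫_ℝ ≤ ⟪g.pseudoGrad x, y⟫_ℝ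
      + ⟪(WithLp.toLp 2 r : Euc m), g.residual y⟫_ℝ := by
    intro y hy
    refine (hr y hy).trans_eq ?_
    simp [PiLp.inner_apply, constraint_apply, mul_comm]
  set l : Euc m := WithLp.toLp 2 r with hl
  -- Testing the Lagrangian bound at x itself gives ≥ 0; feasibility and l ≥ 0 give ≤ 0.
  have hcomp : ⟪l, g.residual x⟫_ℝ = 0 := by
    refine le_antisymm ?_ (by linarith [hr' x hx.1.1])
    rw [PiLp.inner_apply]
    refine Finset.sum_nonpos fun j _ => ?_
    have := mul_nonpos_of_nonneg_of_nonpos (hr0 j) (hx.1.2 j)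
    simpa [hl, mul_comm] using this
  refine ⟨l, fun i => ⟨hx.1.1 i, fun z hz => ?_⟩, hr0, fun y hy => ?_⟩
  · have hbox : x.replace i z ∈ g.box := by
      intro j
      by_cases h : j = i
      · subst h; rw [replace_apply_self]; exact hz
      · rw [replace_apply_of_ne _ _ _ h]; exact hx.1.1 j
    have h1 := hr' _ hbox
    have h2 : g.residual (x.replace i z) - g.residual x
        = Matrix.toEuclideanLin (g.A i) (z - x i) := by
      rw [residual_eq, residual_eq, sub_sub_sub_cancel_right, ← map_sub]
      change ∑ j, Matrix.toEuclideanLin (g.A j) ((x.replace i z - x) j) = _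
      rw [Finset.sum_eq_single i]
      · rw [PiLp.sub_apply, replace_apply_self]
      · intro j _ hj
        rw [PiLp.sub_apply, replace_apply_of_ne _ _ _ hj, sub_self, map_zero]
      · simp
    have h3 := inner_replace_sub x i z (g.pseudoGrad x)
    rw [inner_sub_right] at h3
    have h4 : ⟪l, g.residual (x.replace i z)⟫_ℝ
        = ⟪l, Matrix.toEuclideanLin (g.A i) (z - x i)⟫_ℝ := by
      rw [← h2, inner_sub_right, hcomp, sub_zero]
    rw [inner_neg_left, inner_add_left, inner_toEuclideanLin_transpose]
    linarith
  · rw [inner_sub_right, real_inner_comm l, hcomp, sub_zero, PiLp.inner_apply]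
    refine Finset.sum_nonpos fun j _ => ?_
    have := mul_nonpos_of_nonneg_of_nonpos (hy j) (hx.1.2 j)
    simpa [mul_comm] using this

end AggGame

/-! ### Abstract descent of the preconditioned distance. -/

section Descent

variable {E H : Type*} [NormedAddCommGroup E] [InnerProductSpace ℝ E] [NormedAddCommGroup H]
  [InnerProductSpace ℝ H]

/-- The quadratic form of the preconditioner, in the variables `(x, u - x, z, λ)`. -/
def precondForm (T : E →ₗ[ℝ] E) (Y Al L : H →ₗ[ℝ] H) (Λ : E →ₗ[ℝ] H) (κ : ℝ) (p e : E) (r q : H) :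
    ℝ :=
  ⟪T p, p⟫_ℝ + κ⁻¹ * ⟪e, e⟫_ℝ + ⟪Y r, r⟫_ℝ + ⟪Al q, q⟫_ℝ - 2 * ⟪Λ p, q⟫_ℝ + 2 * ⟪L r, q⟫_ℝ

variable {T : E →ₗ[ℝ] E} {Y Al L : H →ₗ[ℝ] H} {Λ : E →ₗ[ℝ] H} {Λ' : H →ₗ[ℝ] E} {κ : ℝ}

/-- The three-point identity of the preconditioned forward-backward iteration. -/
theorem precondForm_step (hT : ∀ x y, ⟪T x, y⟫_ℝ = ⟪x, T y⟫_ℝ)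
    (hY : ∀ x y, ⟪Y x, y⟫_ℝ = ⟪x, Y y⟫_ℝ) (hAl : ∀ x y, ⟪Al x, y⟫_ℝ = ⟪x, Al y⟫_ℝ)
    (hL : ∀ x y, ⟪L x, y⟫_ℝ = ⟪x, L y⟫_ℝ) (hΛ : ∀ l x, ⟪Λ' l, x⟫_ℝ = ⟪l, Λ x⟫_ℝ) (hκ : 0 < κ)
    {p e dx dv a b : E} {r q dz dl : H} (hdz : Y dz = L q) (hdv : dv = -(κ • b)) :
    precondForm T Y Al L Λ κ (p + dx) (e + dv) (r + dz) (q + dl)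
      = precondForm T Y Al L Λ κ p e r q - precondForm T Y Al L Λ κ dx dv dz dl
        + 2 * ⟪T dx + (a + b) + Λ' q, p + dx⟫_ℝ
        + 2 * ⟪Al dl + L q - Λ (p + (2 : ℝ) • dx) + L (r + (2 : ℝ) • dz), q + dl⟫_ℝ
        - 2 * (⟪a + b, p⟫_ℝ + ⟪b, e⟫_ℝ + ⟪L q, q⟫_ℝ)
        - 2 * (⟪a + b, dx⟫_ℝ + ⟪b, dv⟫_ℝ + ⟪L q, dl⟫_ℝ) := by
  -- With Φ the symmetric bilinear form of the preconditioner, Φ(w+d, w+d) = Φ(w,w) - Φ(d,d) + 2Φ(d,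
  -- w+d). The update rules turn the last term into the two resolvent products minus the forward
  -- products; the skew couplings cancel.
  have t1 : ⟪T p, dx⟫_ℝ = ⟪T dx, p⟫_ℝ := by rw [hT, real_inner_comm]
  have t2 : ⟪Y r, dz⟫_ℝ = ⟪L q, r⟫_ℝ := by rw [hY, hdz, real_inner_comm]
  have t3 : ⟪Al q, dl⟫_ℝ = ⟪Al dl, q⟫_ℝ := by rw [hAl, real_inner_comm]
  have t4 : ⟪L r, q⟫_ℝ = ⟪L q, r⟫_ℝ := by rw [hL, real_inner_comm]
  have t5 : ⟪L dz, q⟫_ℝ = ⟪L q, dz⟫_ℝ := by rw [hL, real_inner_comm]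
  have t6 : ∀ x, ⟪Λ' q, x⟫_ℝ = ⟪Λ x, q⟫_ℝ := fun x => by rw [hΛ, real_inner_comm]
  have t7 : ∀ w, κ⁻¹ * ⟪w, dv⟫_ℝ = -⟪b, w⟫_ℝ := fun w => by
    rw [hdv, inner_neg_right, real_inner_smul_right, real_inner_comm]
    field_simp
  have t8 : ⟪dv, e⟫_ℝ = ⟪e, dv⟫_ℝ := real_inner_comm _ _
  have t9 : ⟪Y dz, r⟫_ℝ = ⟪L q, r⟫_ℝ := by rw [hdz]
  have t10 : ⟪Y dz, dz⟫_ℝ = ⟪L q, dz⟫_ℝ := by rw [hdz]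
  simp only [precondForm, map_add, map_smul, inner_add_left, inner_add_right, inner_sub_left,
    real_inner_smul_left, t1, t2, t3, t4, t5, t6, t8, t9, t10]
  linear_combination 2 * t7 e + 2 * t7 dv

/-- One step of the iteration decreases the preconditioned distance to a fixed point. -/
theorem precondForm_step_le (hT : ∀ x y, ⟪T x, y⟫_ℝ = ⟪x, T y⟫_ℝ)
    (hY : ∀ x y, ⟪Y x, y⟫_ℝ = ⟪x, Y y⟫_ℝ) (hAl : ∀ x y, ⟪Al x, y⟫_ℝ = ⟪x, Al y⟫_ℝ)
    (hL : ∀ x y, ⟪L x, y⟫_ℝ = ⟪x, L y⟫_ℝ) (hΛ : ∀ l x, ⟪Λ' l, x⟫_ℝ = ⟪l, Λ x⟫_ℝ) (hκ : 0 < κ)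
    {D δ δ' ε : ℝ} (hD : 0 < D) (hδ' : 0 < δ')
    (hcoer : ∀ (x v : E) (z l : H), D * ‖x‖ ^ 2 + κ⁻¹ * ‖v‖ ^ 2 + δ * ‖z‖ ^ 2 + δ * ‖l‖ ^ 2
      ≤ precondForm T Y Al L Λ κ x v z l)
    {p e dx dv a b : E} {r q dz dl : H} (hdz : Y dz = L q) (hdv : dv = -(κ • b))
    (hx : ⟪T dx + (a + b) + Λ' q, p + dx⟫_ℝ ≤ 0)
    (hl : ⟪Al dl + L q - Λ (p + (2 : ℝ) • dx) + L (r + (2 : ℝ) • dz), q + dl⟫_ℝ ≤ 0)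
    (hcore : D⁻¹ * ‖a + b‖ ^ 2 + κ * ‖b‖ ^ 2 + ε ≤ 2 * (⟪a, p⟫_ℝ + ⟪b, p + e⟫_ℝ))
    (hlap : ‖L q‖ ^ 2 ≤ 2 * δ' * ⟪L q, q⟫_ℝ) :
    precondForm T Y Al L Λ κ (p + dx) (e + dv) (r + dz) (q + dl)
      ≤ precondForm T Y Al L Λ κ p e r q - ε - (δ - δ') * ‖dl‖ ^ 2 - δ * ‖dz‖ ^ 2 := by
  rw [precondForm_step hT hY hAl hL hΛ hκ (a := a) hdz hdv]
  have h1 := hcoer dx dv dz dl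
  have h2 : ‖dv‖ ^ 2 = κ ^ 2 * ‖b‖ ^ 2 := by rw [hdv, norm_neg, norm_smul, mul_pow]; simp
  have h2' : κ⁻¹ * ‖dv‖ ^ 2 = κ * ‖b‖ ^ 2 := by rw [h2]; field_simp
  -- As dv is explicit, no Young inequality is needed here: 2κ‖b‖² from the product minus κ‖b‖² from
  -- the metric leaves κ‖b‖².
  have h3 : ⟪b, dv⟫_ℝ = -(κ * ‖b‖ ^ 2) := by
    rw [hdv, inner_neg_right, real_inner_smul_right, real_inner_self_eq_norm_sq]
  have h4 : -(2 * ⟪a + b, dx⟫_ℝ) ≤ D * ‖dx‖ ^ 2 + D⁻¹ * ‖a + b‖ ^ 2 := by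
    have h := sq_nonneg ‖D • dx + (a + b)‖
    rw [norm_add_sq_real, norm_smul, Real.norm_of_nonneg hD.le, real_inner_smul_left, mul_pow,
      real_inner_comm] at h
    have h' := mul_nonneg (inv_pos.2 hD).le h
    have e : D⁻¹ * (D ^ 2 * ‖dx‖ ^ 2 + 2 * (D * ⟪a + b, dx⟫_ℝ) + ‖a + b‖ ^ 2)
        = D * ‖dx‖ ^ 2 + 2 * ⟪a + b, dx⟫_ℝ + D⁻¹ * ‖a + b‖ ^ 2 := by field_simp
    linarith
  -- Weight δ' < δ lets cocoercivity of L absorb ‖Lq‖² and keeps (δ - δ')‖dl‖² as decrease.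
  have h5 : -(2 * ⟪L q, dl⟫_ℝ) ≤ δ' * ‖dl‖ ^ 2 + 2 * ⟪L q, q⟫_ℝ := by
    have h := sq_nonneg ‖δ' • dl + L q‖
    rw [norm_add_sq_real, norm_smul, Real.norm_of_nonneg hδ'.le, real_inner_smul_left, mul_pow,
      real_inner_comm] at h
    have h' : 0 ≤ δ' * (δ' * ‖dl‖ ^ 2 + 2 * ⟪L q, dl⟫_ℝ + 2 * ⟪L q, q⟫_ℝ) := by nlinarith
    linarith [nonneg_of_mul_nonneg_right h' hδ']
  have h6 : ⟪a + b, p⟫_ℝ + ⟪b, e⟫_ℝ = ⟪a, p⟫_ℝ + ⟪b, p + e⟫_ℝ := by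
    rw [inner_add_left, inner_add_right]; ring
  linarith

end Descent

/-! ### Block operators and diagonal dominance of the preconditioner. -/

section BlockMaps

variable {N n m d : ℕ}

/-- Blockwise multiplication by scalars. -/
def blockScale (a : Fin N → ℝ) (d : ℕ) : Profile N d →ₗ[ℝ] Profile N d where
  toFun w := WithLp.toLp 2 fun i => a i • w i
  map_add' v w := by ext1 i; simp
  map_smul' c w := by ext1 i; simp [smul_comm (a i) c]

theorem blockScale_apply (a : Fin N → ℝ) (w : Profile N d) (i : Fin N) :
    blockScale a d w i = a i • w i := rfl

theorem blockScale_symm (a : Fin N → ℝ) (v w : Profile N d) :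
    ⟪blockScale a d v, w⟫_ℝ = ⟪v, blockScale a d w⟫_ℝ := by
  rw [PiLp.inner_apply, PiLp.inner_apply]
  exact Finset.sum_congr rfl fun i _ => by
    rw [blockScale_apply, blockScale_apply, real_inner_smul_left, real_inner_smul_right]

/-- The block diagonal map `col(x_i) ↦ col(B_i x_i)`. -/
def blockMap (B : Fin N → Matrix (Fin m) (Fin n) ℝ) : Profile N n →ₗ[ℝ] Profile N m where
  toFun w := WithLp.toLp 2 fun i => Matrix.toEuclideanLin (B i) (w i)
  map_add' v w := by ext1 i; simp
  map_smul' c w := by ext1 i; simp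

theorem blockMap_apply (B : Fin N → Matrix (Fin m) (Fin n) ℝ) (w : Profile N n) (i : Fin N) :
    blockMap B w i = Matrix.toEuclideanLin (B i) (w i) := rfl

theorem inner_blockMap_transpose (B : Fin N → Matrix (Fin m) (Fin n) ℝ) (l : Profile N m)
    (x : Profile N n) : ⟪blockMap (fun i => (B i).transpose) l, x⟫_ℝ = ⟪l, blockMap B x⟫_ℝ := by
  simp only [PiLp.inner_apply (𝕜 := ℝ) (f := fun _ : Fin N => Euc m),
    PiLp.inner_apply (𝕜 := ℝ) (f := fun _ : Fin N => Euc n), blockMap_apply,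
    inner_toEuclideanLin_transpose]

/-- Entrywise 2|A_jk x_k l_j| ≤ |A_jk|(x_k² + l_j²); column sums then weigh x and row sums weigh l,
as in Gershgorin's theorem. -/
theorem two_mul_inner_toEuclideanLin_le (A : Matrix (Fin m) (Fin n) ℝ) (x : Euc n) (l : Euc m) :
    2 * ⟪Matrix.toEuclideanLin A x, l⟫_ℝ
      ≤ (⨆ j : Fin n, ∑ k : Fin m, |A.transpose j k|) * ‖x‖ ^ 2
        + (⨆ j : Fin m, ∑ k : Fin n, |A j k|) * ‖l‖ ^ 2 := by
  have h1 : 2 * ⟪Matrix.toEuclideanLin A x, l⟫_ℝ = ∑ j, ∑ k, 2 * (A j k * x k * l j) := by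
    simp [PiLp.inner_apply, Matrix.toLpLin_apply, Matrix.mulVec, dotProduct, Finset.mul_sum,
      mul_comm]
  have h2 : ∀ j k, 2 * (A j k * x k * l j) ≤ |A j k| * x k ^ 2 + |A j k| * l j ^ 2 := by
    intro j k
    have h := abs_nonneg (A j k)
    rcases abs_cases (A j k) with ⟨e, _⟩ | ⟨e, _⟩
    · nlinarith [mul_nonneg h (sq_nonneg (x k - l j))]
    · nlinarith [mul_nonneg h (sq_nonneg (x k + l j))]
  have h3 : ∀ k, (∑ j, |A j k|) * x k ^ 2
      ≤ (⨆ j : Fin n, ∑ k : Fin m, |A.transpose j k|) * x k ^ 2 := fun k =>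
    mul_le_mul_of_nonneg_right
      (le_ciSup (f := fun j : Fin n => ∑ k : Fin m, |A.transpose j k|)
        (Set.finite_range _).bddAbove k) (sq_nonneg _)
  have h4 : ∀ j, (∑ k, |A j k|) * l j ^ 2 ≤ (⨆ j : Fin m, ∑ k : Fin n, |A j k|) * l j ^ 2 :=
    fun j => mul_le_mul_of_nonneg_right
      (le_ciSup (f := fun j : Fin m => ∑ k : Fin n, |A j k|)
        (Set.finite_range _).bddAbove j) (sq_nonneg _)
  rw [h1, EuclideanSpace.real_norm_sq_eq, EuclideanSpace.real_norm_sq_eq, Finset.mul_sum,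
    Finset.mul_sum]
  calc ∑ j, ∑ k, 2 * (A j k * x k * l j)
      ≤ ∑ j, ∑ k, (|A j k| * x k ^ 2 + |A j k| * l j ^ 2) :=
        Finset.sum_le_sum fun j _ => Finset.sum_le_sum fun k _ => h2 j k
    _ = ∑ k, (∑ j, |A j k|) * x k ^ 2 + ∑ j, (∑ k, |A j k|) * l j ^ 2 := by
        simp only [Finset.sum_add_distrib, Finset.sum_mul]
        rw [Finset.sum_comm]
    _ ≤ _ := add_le_add (Finset.sum_le_sum fun k _ => h3 k) (Finset.sum_le_sum fun j _ => h4 j)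

/-- The same argument for L, whose absolute row sums are 2d_i. -/
theorem neg_two_mul_inner_lap_le (G : SimpleGraph (Fin N)) [DecidableRel G.Adj]
    (z l : Profile N d) :
    -(2 * ⟪lap G d z, l⟫_ℝ)
      ≤ ∑ i, 2 * (G.degree i : ℝ) * ‖z i‖ ^ 2 + ∑ i, 2 * (G.degree i : ℝ) * ‖l i‖ ^ 2 := by
  have h1 : -(2 * ⟪lap G d z, l⟫_ℝ)
      = ∑ i, ∑ j ∈ G.neighborFinset i, -(2 * ⟪z i - z j, l i⟫_ℝ) := by
    simp only [PiLp.inner_apply (𝕜 := ℝ) (f := fun _ : Fin N => Euc d), lap_apply, disagreement,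
      sum_inner, Finset.mul_sum, Finset.sum_neg_distrib]
  have h2 : ∀ i j, -(2 * ⟪z i - z j, l i⟫_ℝ) ≤ ‖z i‖ ^ 2 + ‖z j‖ ^ 2 + 2 * ‖l i‖ ^ 2 := by
    intro i j
    have e1 := sq_nonneg ‖z i + l i‖
    have e2 := sq_nonneg ‖z j - l i‖
    rw [norm_add_sq_real] at e1
    rw [norm_sub_sq_real] at e2
    rw [inner_sub_left]
    linarith
  have h3 : ∑ i, ∑ j ∈ G.neighborFinset i, ‖z j‖ ^ 2 = ∑ i, (G.degree i : ℝ) * ‖z i‖ ^ 2 := by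
    have : ∑ i, ∑ j ∈ G.neighborFinset i, ‖z j‖ ^ 2
        = ∑ j, ∑ i ∈ G.neighborFinset j, ‖z j‖ ^ 2 :=
      Finset.sum_comm' fun i j => by simp [G.adj_comm]
    rw [this]
    simp
  rw [h1]
  calc _ ≤ ∑ i, ∑ j ∈ G.neighborFinset i, (‖z i‖ ^ 2 + ‖z j‖ ^ 2 + 2 * ‖l i‖ ^ 2) :=
        Finset.sum_le_sum fun i _ => Finset.sum_le_sum fun j _ => h2 i j
    _ = _ := by
        simp only [Finset.sum_add_distrib, h3, Finset.sum_const,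
          SimpleGraph.card_neighborFinset_eq_degree, nsmul_eq_mul]
        rw [← Finset.sum_add_distrib]
        congr 1
        · exact Finset.sum_congr rfl fun i _ => by ring
        · exact Finset.sum_congr rfl fun i _ => by ring

/-- Diagonal dominance of the preconditioner under the decentralized step-size bounds. -/
theorem StepSizesOK.precondForm_ge {g : AggGame N n m} {G : SimpleGraph (Fin N)}
    [DecidableRel G.Adj] {δ κ : ℝ} {τ υ α : Fin N → ℝ} (h : StepSizesOK g G δ κ τ υ α)
    (hδ : 0 < δ) (hκ : 0 < κ) (hκδ : κ * δ < 1) (x v : Profile N n) (z l : Profile N m) :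
    (δ + 1 / (κ * (1 - κ * δ))) * ‖x‖ ^ 2 + κ⁻¹ * ‖v‖ ^ 2 + δ * ‖z‖ ^ 2 + δ * ‖l‖ ^ 2
      ≤ precondForm (blockScale (fun i => (τ i)⁻¹) n) (blockScale (fun i => (υ i)⁻¹) m)
          (blockScale (fun i => (α i)⁻¹) m) (lap G m) (blockMap g.A) κ x v z l := by
  have hD : 0 < δ + 1 / (κ * (1 - κ * δ)) := by
    have : 0 < 1 - κ * δ := by linarith
    positivity
  set D := δ + 1 / (κ * (1 - κ * δ)) with hDdef
  have hform : ∀ (a : Fin N → ℝ) (d : ℕ) (w : Profile N d),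
      ⟪blockScale a d w, w⟫_ℝ = ∑ i, a i * ‖w i‖ ^ 2 := by
    intro a d w
    rw [PiLp.inner_apply]
    exact Finset.sum_congr rfl fun i _ => by
      rw [blockScale_apply, real_inner_smul_left, real_inner_self_eq_norm_sq]
  have hsup1 : ∀ i, 0 ≤ ⨆ j : Fin n, ∑ k : Fin m, |(g.A i).transpose j k| := fun i =>
    Real.iSup_nonneg fun j => Finset.sum_nonneg fun k _ => abs_nonneg _
  have hsup2 : ∀ i, 0 ≤ ⨆ j : Fin m, ∑ k : Fin n, |g.A i j k| := fun i =>
    Real.iSup_nonneg fun j => Finset.sum_nonneg fun k _ => abs_nonneg _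
  have hdeg : ∀ i, 0 ≤ 2 * (G.degree i : ℝ) := fun i => by positivity
  have hτ : ∀ i, (⨆ j : Fin n, ∑ k : Fin m, |(g.A i).transpose j k|) + D ≤ (τ i)⁻¹ := by
    intro i
    have h1 := h.tau_le i
    rw [add_assoc, ← hDdef, one_div] at h1
    exact (le_inv_comm₀ (h.tau_pos i) (by linarith [hsup1 i])).1 h1
  have hυ : ∀ i, 2 * (G.degree i : ℝ) + δ ≤ (υ i)⁻¹ := fun i =>
    (le_inv_comm₀ (h.upsilon_pos i) (by linarith [hdeg i])).1 (h.upsilon_le i)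
  have hα : ∀ i, (⨆ j : Fin m, ∑ k : Fin n, |g.A i j k|) + 2 * (G.degree i : ℝ) + δ ≤ (α i)⁻¹ :=
    fun i => (le_inv_comm₀ (h.alpha_pos i) (by linarith [hdeg i, hsup2 i])).1 (h.alpha_le i)
  have hA : 2 * ⟪blockMap g.A x, l⟫_ℝ
      ≤ ∑ i, (⨆ j : Fin n, ∑ k : Fin m, |(g.A i).transpose j k|) * ‖x i‖ ^ 2
        + ∑ i, (⨆ j : Fin m, ∑ k : Fin n, |g.A i j k|) * ‖l i‖ ^ 2 := by
    rw [PiLp.inner_apply, Finset.mul_sum, ← Finset.sum_add_distrib]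
    exact Finset.sum_le_sum fun i _ => two_mul_inner_toEuclideanLin_le _ _ _
  have hLap := neg_two_mul_inner_lap_le G z l
  have b1 : ∑ i, ((⨆ j : Fin n, ∑ k : Fin m, |(g.A i).transpose j k|) + D) * ‖x i‖ ^ 2
      ≤ ∑ i, (τ i)⁻¹ * ‖x i‖ ^ 2 :=
    Finset.sum_le_sum fun i _ => mul_le_mul_of_nonneg_right (hτ i) (sq_nonneg _)
  have b2 : ∑ i, (2 * (G.degree i : ℝ) + δ) * ‖z i‖ ^ 2 ≤ ∑ i, (υ i)⁻¹ * ‖z i‖ ^ 2 :=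
    Finset.sum_le_sum fun i _ => mul_le_mul_of_nonneg_right (hυ i) (sq_nonneg _)
  have b3 : ∑ i, ((⨆ j : Fin m, ∑ k : Fin n, |g.A i j k|) + 2 * (G.degree i : ℝ) + δ) * ‖l i‖ ^ 2
      ≤ ∑ i, (α i)⁻¹ * ‖l i‖ ^ 2 :=
    Finset.sum_le_sum fun i _ => mul_le_mul_of_nonneg_right (hα i) (sq_nonneg _)
  rw [precondForm, hform, hform, hform, real_inner_self_eq_norm_sq]
  simp only [add_mul, Finset.sum_add_distrib, ← Finset.mul_sum, ← PiLp.norm_sq_eq_of_L2] at b1 b2 b3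
  linarith

end BlockMaps

/-! ### Cocoercivity of the forward operator on the subspace of equal averages. -/

section Core

variable {N n m : ℕ}

theorem avg_sub (x y : Profile N n) : (x - y).avg = x.avg - y.avg := by
  simp [Profile.avg, smul_sub]

theorem consensus_sub (y z : Euc n) : consensus N (y - z) = consensus N y - consensus N z := rfl

theorem norm_sq_eq_consensus_add (hN : 2 ≤ N) (x : Profile N n) :
    ‖x‖ ^ 2 = ‖consensus N x.avg‖ ^ 2 + ‖x - consensus N x.avg‖ ^ 2 := by
  have h : ⟪consensus N x.avg, x - consensus N x.avg⟫_ℝ = 0 := by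
    rw [inner_consensus, sum_sub_consensus_avg hN, inner_zero_right]
  have e : x = consensus N x.avg + (x - consensus N x.avg) := by abel
  conv_lhs => rw [e]
  rw [norm_add_sq_real, h]
  ring

theorem norm_consensus_avg_le (hN : 2 ≤ N) (x : Profile N n) : ‖consensus N x.avg‖ ≤ ‖x‖ := by
  have h := norm_sq_eq_consensus_add hN x
  exact abs_le_of_sq_le_sq' (by nlinarith [sq_nonneg ‖x - consensus N x.avg‖]) (norm_nonneg _) |>.2

/-- The distance of `u` to the target consensus, when `u` and `x` have the same average. -/
theorem norm_sub_consensus_le (hN : 2 ≤ N) {x u : Profile N n} (h : u.avg = x.avg)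
    (y : Profile N n) :
    ‖u - consensus N y.avg‖ ≤ √(‖x - y‖ ^ 2 + ‖u - consensus N u.avg‖ ^ 2) := by
  refine Real.le_sqrt_of_sq_le ?_
  -- Pythagoras: the average part equals that of x - y, and averaging does not increase the norm.
  have h1 := norm_sq_eq_consensus_add hN (u - consensus N y.avg)
  have h0 : (consensus N y.avg).avg = y.avg := by
    have : (N : ℝ) ≠ 0 := by positivity
    simp [Profile.avg, ← Nat.cast_smul_eq_nsmul ℝ, smul_smul, this]
  rw [avg_sub, h0] at h1
  have e : u - consensus N y.avg - consensus N (u.avg - y.avg) = u - consensus N u.avg := by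
    rw [consensus_sub]; abel
  rw [e, h, ← avg_sub] at h1
  have h2 := pow_le_pow_left₀ (norm_nonneg _) (norm_consensus_avg_le hN (x - y)) 2
  rw [h1, h]
  linarith

/-- Restricted cocoercivity of the forward operator relative to the step sizes. -/
theorem AggGame.forward_cocoercive (hN : 2 ≤ N) (g : AggGame N n m) (G : SimpleGraph (Fin N))
    [DecidableRel G.Adj] {μ lu lx c δ κ : ℝ} (hlu : 0 < lu) (hlx : 0 < lx)
    (hF_mono : ∀ x y : Profile N n,
      μ * ‖x - y‖ ^ 2 ≤ inner ℝ (x - y) (g.pseudoGrad x - g.pseudoGrad y))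
    (hext_u : ∀ x u v : Profile N n,
      ‖g.extPseudoGrad x u - g.extPseudoGrad x v‖ ≤ lu * ‖u - v‖)
    (hext_x : ∀ x y u : Profile N n,
      ‖g.extPseudoGrad x u - g.extPseudoGrad y u‖ ≤ lx * ‖x - y‖)
    (hc : 0 < c) (hδ : 0 < δ) (hκ : 0 < κ) (hκδ : κ * δ < 1) (hl2 : 0 < lambdaTwo hN G)
    (xs x u : Profile N n) (h : u.avg = x.avg) :
    (δ + 1 / (κ * (1 - κ * δ)))⁻¹
          * ‖(g.extPseudoGrad x u - g.pseudoGrad xs) + c • lap G n u‖ ^ 2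
        + κ * ‖c • lap G n u‖ ^ 2
        + (2 * muTilde μ lu (c * lambdaTwo hN G)
            - max (lx ^ 2) (lu ^ 2 + (c * lambdaMax hN G) ^ 2) / δ)
          * (‖x - xs‖ ^ 2 + ‖u - consensus N u.avg‖ ^ 2)
      ≤ 2 * (⟪g.extPseudoGrad x u - g.pseudoGrad xs, x - xs⟫_ℝ
          + ⟪c • lap G n u, u - consensus N xs.avg⟫_ℝ) := by
  set X := ‖x - xs‖ with hX
  set U := ‖u - consensus N u.avg‖ with hU
  set a := g.extPseudoGrad x u - g.pseudoGrad xs with ha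
  set b := c • lap G n u with hb
  set Θ := max (lx ^ 2) (lu ^ 2 + (c * lambdaMax hN G) ^ 2) with hΘ
  have hmax : 0 < lambdaMax hN G := hl2.trans_le (lambdaTwo_le_lambdaMax G hN)
  have hX0 : 0 ≤ X := norm_nonneg _
  have hU0 : 0 ≤ U := norm_nonneg _
  have hΘ0 : 0 < Θ := lt_of_lt_of_le (by positivity) (le_max_left _ _)
  have hanorm : ‖a‖ ≤ lx * X + lu * √(X ^ 2 + U ^ 2) := by
    rw [ha, ← extPseudoGrad_consensus]
    refine (norm_sub_le_norm_sub_add_norm_sub _ (g.extPseudoGrad xs u) _).trans ?_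
    refine add_le_add (hext_x _ _ _) ((hext_u _ _ _).trans ?_)
    exact mul_le_mul_of_nonneg_left (norm_sub_consensus_le hN h xs) hlu.le
  have hbnorm : ‖b‖ ≤ (c * lambdaMax hN G) * U := by
    rw [hb, norm_smul, Real.norm_of_nonneg hc.le, mul_assoc]
    exact mul_le_mul_of_nonneg_left (norm_lap_le G hN hmax.le u) hc.le
  have hbound := forward_step_bound (θ := √Θ) hδ hκ hκδ hlu.le (mul_pos hc hmax).le
    (Real.sqrt_pos.2 hΘ0) (Real.le_sqrt_of_sq_le (le_max_left _ _))
    (by rw [Real.sq_sqrt hΘ0.le]; exact le_max_right _ _) hX0 hU0 (norm_nonneg a) (norm_nonneg b)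
    hanorm hbnorm
  rw [Real.sq_sqrt hΘ0.le] at hbound
  have hD : 0 < δ + 1 / (κ * (1 - κ * δ)) := by
    have : 0 < 1 - κ * δ := by linarith
    positivity
  have hab : ‖a + b‖ ^ 2 ≤ (‖a‖ + ‖b‖) ^ 2 :=
    pow_le_pow_left₀ (norm_nonneg _) (norm_add_le a b) 2
  have hcost : (δ + 1 / (κ * (1 - κ * δ)))⁻¹ * ‖a + b‖ ^ 2 + κ * ‖b‖ ^ 2
      ≤ Θ / δ * (X ^ 2 + U ^ 2) := by
    rw [div_mul_eq_mul_div, le_div_iff₀ hδ, mul_comm _ δ]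
    refine le_trans ?_ hbound
    gcongr
  -- Replacing u by its consensus part, whose average is σ(x), recovers the strongly monotone F at
  -- an error of at most lu·U·X.
  have hinner1 : μ * X ^ 2 - lu * U * X ≤ ⟪a, x - xs⟫_ℝ := by
    have e : a = (g.extPseudoGrad x u - g.extPseudoGrad x (consensus N u.avg))
        + (g.pseudoGrad x - g.pseudoGrad xs) := by
      rw [ha, h, extPseudoGrad_consensus]; abel
    rw [e, inner_add_left]
    have h1 := hF_mono x xs
    rw [real_inner_comm] at h1
    have h2 := (abs_le.1 (abs_real_inner_le_norm
      (g.extPseudoGrad x u - g.extPseudoGrad x (consensus N u.avg)) (x - xs))).1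
    have h3 := mul_le_mul_of_nonneg_right (hext_u x u (consensus N u.avg)) hX0
    linarith
  have hinner2 : c * lambdaTwo hN G * U ^ 2 ≤ ⟪b, u - consensus N xs.avg⟫_ℝ := by
    rw [hb, real_inner_smul_left, inner_sub_right, lap_symm _ _ (consensus N xs.avg), lap_consensus,
      inner_zero_right, sub_zero, mul_assoc]
    exact mul_le_mul_of_nonneg_left (lambdaTwo_mul_norm_sq_le G hN hl2 u) hc.le
  have hmu := muTilde_mul_le μ lu (c * lambdaTwo hN G) X U
  linarith

end Core

/-! ### Stationary points of the iteration and KKT pairs. -/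

section Saddle

variable {N n m : ℕ}

/-- Stationary points of the iteration: a common multiplier `l` together with auxiliary variables
`z` that split the complementarity condition among the agents. -/
structure AggGame.IsStationary (g : AggGame N n m) (G : SimpleGraph (Fin N)) [DecidableRel G.Adj]
    (x : Profile N n) (z : Profile N m) (l : Euc m) : Prop where
  mem_box : x ∈ g.box
  mem_orthant : l ∈ orthant m
  primal : ∀ y ∈ g.box,
    0 ≤ ⟪g.pseudoGrad x + blockMap (fun i => (g.A i).transpose) (consensus N l), y - x⟫_ℝ
  dual : ∀ i, ∀ y ∈ orthant m,
    0 ≤ ⟪g.b i - Matrix.toEuclideanLin (g.A i) (x i) + lap G m z i, y - l⟫_ℝ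

variable {g : AggGame N n m} {G : SimpleGraph (Fin N)} [DecidableRel G.Adj]

/-- Summing the agents' dual inequalities removes Lz, because the Laplacian has zero block sum. -/
theorem AggGame.IsStationary.isKKT {x : Profile N n} {z : Profile N m} {l : Euc m}
    (h : g.IsStationary G x z l) : g.IsKKT x l := by
  refine ⟨fun i => ⟨h.mem_box i, fun y hy => ?_⟩, h.mem_orthant, fun y hy => ?_⟩
  · have h1 := h.primal (x.replace i y) (fun j => by
      by_cases hj : j = i
      · subst hj; rw [replace_apply_self]; exact hy
      · rw [replace_apply_of_ne _ _ _ hj]; exact h.mem_box j)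
    rw [inner_replace_sub] at h1
    rw [inner_neg_left]
    exact neg_nonpos.2 h1
  · have h1 : 0 ≤ ∑ i, ⟪g.b i - Matrix.toEuclideanLin (g.A i) (x i) + lap G m z i, y - l⟫_ℝ :=
      Finset.sum_nonneg fun i _ => h.dual i y hy
    rw [← sum_inner, Finset.sum_add_distrib, sum_lap, add_zero, Finset.sum_sub_distrib,
      ← neg_sub, inner_neg_left] at h1
    exact neg_nonneg.1 h1

theorem AggGame.IsKKT.exists_isStationary (hN : 2 ≤ N) (hl2 : 0 < lambdaTwo hN G)
    {x : Profile N n} {l : Euc m} (h : g.IsKKT x l) : ∃ z, g.IsStationary G x z l := by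
  have hN0 : (N : ℝ) ≠ 0 := by positivity
  -- This z redistributes the local residuals so that every agent sees the same share, 1/N of the
  -- total; the right-hand side has zero sum.
  obtain ⟨z, hz⟩ := exists_lap_eq G hN hl2 (y := WithLp.toLp 2 fun i =>
    Matrix.toEuclideanLin (g.A i) (x i) - g.b i - (N : ℝ)⁻¹ • g.residual x) (by
      simp only [Finset.sum_sub_distrib]
      simp [AggGame.residual, ← Nat.cast_smul_eq_nsmul ℝ, smul_smul, hN0])
  refine ⟨z, fun i => (h.1 i).1, h.2.1, fun y hy => ?_, fun i y hy => ?_⟩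
  · rw [PiLp.inner_apply]
    refine Finset.sum_nonneg fun i _ => ?_
    have h1 := (h.1 i).2 (y i) (hy i)
    rw [inner_neg_left] at h1
    exact neg_nonpos.1 h1
  · rw [hz]
    have e : g.b i - Matrix.toEuclideanLin (g.A i) (x i)
        + (Matrix.toEuclideanLin (g.A i) (x i) - g.b i - (N : ℝ)⁻¹ • g.residual x)
        = -((N : ℝ)⁻¹ • g.residual x) := by abel
    change 0 ≤ ⟪g.b i - Matrix.toEuclideanLin (g.A i) (x i)
        + (Matrix.toEuclideanLin (g.A i) (x i) - g.b i - (N : ℝ)⁻¹ • g.residual x), y - l⟫_ℝ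
    rw [e, inner_neg_left, real_inner_smul_left]
    have h1 := h.2.2 y hy
    have h2 : 0 ≤ (N : ℝ)⁻¹ := by positivity
    linarith [mul_nonpos_of_nonneg_of_nonpos h2 h1]

end Saddle

/-! ### The algorithm as a resolvent step, and its Lyapunov decrease. -/

section Run

variable {N n m : ℕ} {g : AggGame N n m} {G : SimpleGraph (Fin N)} [DecidableRel G.Adj]
  {c κ : ℝ} {τ υ α : Fin N → ℝ} {x u : ℕ → Profile N n} {z lam : ℕ → Profile N m}

/-- Dividing the projection inequality by t puts the inverse step size on the increment, which is
how the diagonal of the preconditioner arises. -/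
theorem proj_step {d : ℕ} {S : Set (Euc d)} (hne : S.Nonempty) (hcl : IsClosed S)
    (hS : Convex ℝ S) {t : ℝ} (ht : 0 < t) (w h : Euc d) {p : Euc d} (hp : p = proj S (w - t • h)) :
    p ∈ S ∧ ∀ y ∈ S, 0 ≤ ⟪t⁻¹ • (p - w) + h, y - p⟫_ℝ := by
  obtain ⟨h1, h2⟩ := proj_spec hne hcl hS (w - t • h)
  rw [← hp] at h1 h2
  refine ⟨h1, fun y hy => ?_⟩
  have h3 := h2 y hy
  have e : t⁻¹ • (p - w) + h = -(t⁻¹ • (w - t • h - p)) := by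
    rw [smul_sub, smul_sub, smul_sub, smul_smul, inv_mul_cancel₀ ht.ne', one_smul]; abel
  rw [e, inner_neg_left, real_inner_smul_left]
  linarith [mul_nonpos_of_nonneg_of_nonpos (inv_pos.2 ht).le h3]

theorem IsRun.x_inequality (hrun : IsRun g G c κ τ υ α x u z lam) (hg : g.Regular)
    (hτ : ∀ i, 0 < τ i) (k : ℕ) :
    x (k + 1) ∈ g.box ∧ ∀ y ∈ g.box,
      0 ≤ ⟪blockScale (fun i => (τ i)⁻¹) n (x (k + 1) - x k) + (g.extPseudoGrad (x k) (u k)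
        + blockMap (fun i => (g.A i).transpose) (lam k) + c • lap G n (u k)), y - x (k + 1)⟫_ℝ := by
  have h := fun i => proj_step ⟨_, hrun.x_zero i⟩ (hg.isCompact i).isClosed (hg.convex i) (hτ i) _ _
    (hrun.x_succ k i)
  refine ⟨fun i => (h i).1, fun y hy => ?_⟩
  rw [PiLp.inner_apply]
  exact Finset.sum_nonneg fun i _ => (h i).2 (y i) (hy i)

theorem IsRun.lam_inequality (hrun : IsRun g G c κ τ υ α x u z lam) (hα : ∀ i, 0 < α i) (k : ℕ)
    (i : Fin N) :
    lam (k + 1) i ∈ orthant m ∧ ∀ y ∈ orthant m,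
      0 ≤ ⟪(α i)⁻¹ • (lam (k + 1) i - lam k i) + (lap G m (lam k) i + g.b i
        - Matrix.toEuclideanLin (g.A i) ((2 : ℝ) • x (k + 1) i - x k i)
        + lap G m ((2 : ℝ) • z (k + 1) - z k) i), y - lam (k + 1) i⟫_ℝ :=
  proj_step (orthant_nonempty m) (isClosed_orthant m) (convex_orthant m) (hα i) _ _
    (hrun.lam_succ k i)

theorem IsRun.u_succ_eq (hrun : IsRun g G c κ τ υ α x u z lam) (k : ℕ) :
    u (k + 1) = u k - κ • (c • lap G n (u k)) + (x (k + 1) - x k) := by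
  ext1 i
  rw [hrun.u_succ k i, smul_smul]
  rfl

theorem IsRun.z_succ_eq (hrun : IsRun g G c κ τ υ α x u z lam) (k : ℕ) :
    z (k + 1) = z k + blockScale υ m (lap G m (lam k)) := by
  ext1 i
  rw [hrun.z_succ k i]
  rfl

theorem IsRun.scaled_z_step (hrun : IsRun g G c κ τ υ α x u z lam) (hυ : ∀ i, 0 < υ i) (k : ℕ) :
    blockScale (fun i => (υ i)⁻¹) m (z (k + 1) - z k) = lap G m (lam k) := by
  ext1 i
  rw [hrun.z_succ_eq, add_sub_cancel_left, blockScale_apply, blockScale_apply, smul_smul,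
    inv_mul_cancel₀ (hυ i).ne', one_smul]

/-- Disagreements sum to zero, so u tracks the average of x from the equal start; this is where the
initialization u₀ = x₀ matters. -/
theorem IsRun.avg_eq (hrun : IsRun g G c κ τ υ α x u z lam) (k : ℕ) : (u k).avg = (x k).avg := by
  induction k with
  | zero => rw [show u 0 = x 0 from by ext1 i; exact hrun.u_zero i]
  | succ k ih =>
    have h : ∑ i, u (k + 1) i = ∑ i, u k i + (∑ i, x (k + 1) i - ∑ i, x k i) := by
      rw [hrun.u_succ_eq]
      simp only [PiLp.add_apply, PiLp.sub_apply, PiLp.smul_apply, Finset.sum_add_distrib,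
        Finset.sum_sub_distrib, ← Finset.smul_sum, sum_lap, smul_zero, sub_zero]
    have h' : (1 / (N : ℝ)) • ∑ i, u k i = (1 / (N : ℝ)) • ∑ i, x k i := ih
    rw [Profile.avg, Profile.avg, h, smul_add, h', ← smul_add]
    congr 1
    abel

/-- The squared preconditioned distance between the `k`-th iterate and a stationary point. -/
def lyapunov (g : AggGame N n m) (G : SimpleGraph (Fin N)) [DecidableRel G.Adj] (κ : ℝ)
    (τ υ α : Fin N → ℝ) (xs : Profile N n) (zs : Profile N m) (ls : Euc m)
    (x u : Profile N n) (z lam : Profile N m) : ℝ :=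
  precondForm (blockScale (fun i => (τ i)⁻¹) n) (blockScale (fun i => (υ i)⁻¹) m)
    (blockScale (fun i => (α i)⁻¹) m) (lap G m) (blockMap g.A) κ
    (x - xs) ((u - x) - (consensus N xs.avg - xs)) (z - zs) (lam - consensus N ls)

/-- Subtracting the stationarity inequalities from those of the projections, each tested at the
other's point, gives the two sign conditions of `precondForm_step_le`. -/
theorem IsRun.lyapunov_succ_le (hrun : IsRun g G c κ τ υ α x u z lam) (hg : g.Regular)
    (hτ : ∀ i, 0 < τ i) (hυ : ∀ i, 0 < υ i) (hα : ∀ i, 0 < α i) (hκ : 0 < κ)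
    {D δ δ' ε : ℝ} (hD : 0 < D) (hδ' : 0 < δ')
    (hcoer : ∀ (x v : Profile N n) (z l : Profile N m),
      D * ‖x‖ ^ 2 + κ⁻¹ * ‖v‖ ^ 2 + δ * ‖z‖ ^ 2 + δ * ‖l‖ ^ 2
      ≤ precondForm (blockScale (fun i => (τ i)⁻¹) n) (blockScale (fun i => (υ i)⁻¹) m)
          (blockScale (fun i => (α i)⁻¹) m) (lap G m) (blockMap g.A) κ x v z l)
    {xs : Profile N n} {zs : Profile N m} {ls : Euc m} (hst : g.IsStationary G xs zs ls)
    (hcore : ∀ x u : Profile N n, u.avg = x.avg →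
      D⁻¹ * ‖(g.extPseudoGrad x u - g.pseudoGrad xs) + c • lap G n u‖ ^ 2
        + κ * ‖c • lap G n u‖ ^ 2 + ε * (‖x - xs‖ ^ 2 + ‖u - consensus N u.avg‖ ^ 2)
      ≤ 2 * (⟪g.extPseudoGrad x u - g.pseudoGrad xs, x - xs⟫_ℝ
          + ⟪c • lap G n u, u - consensus N xs.avg⟫_ℝ))
    (hlap : ∀ q : Profile N m, ‖lap G m q‖ ^ 2 ≤ 2 * δ' * ⟪lap G m q, q⟫_ℝ) (k : ℕ) :
    lyapunov g G κ τ υ α xs zs ls (x (k + 1)) (u (k + 1)) (z (k + 1)) (lam (k + 1))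
      ≤ lyapunov g G κ τ υ α xs zs ls (x k) (u k) (z k) (lam k)
        - ε * (‖x k - xs‖ ^ 2 + ‖u k - consensus N (u k).avg‖ ^ 2)
        - (δ - δ') * ‖lam (k + 1) - lam k‖ ^ 2 - δ * ‖z (k + 1) - z k‖ ^ 2 := by
  have hlq : lap G m (lam k - consensus N ls) = lap G m (lam k) := by
    rw [map_sub, lap_consensus, sub_zero]
  have hstep := precondForm_step_le (T := blockScale (fun i => (τ i)⁻¹) n)
    (Y := blockScale (fun i => (υ i)⁻¹) m) (Al := blockScale (fun i => (α i)⁻¹) m)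
    (L := lap G m) (Λ := blockMap g.A) (Λ' := blockMap fun i => (g.A i).transpose)
    (κ := κ) (D := D) (δ := δ) (δ' := δ')
    (ε := ε * (‖x k - xs‖ ^ 2 + ‖u k - consensus N (u k).avg‖ ^ 2))
    (p := x k - xs) (e := (u k - x k) - (consensus N xs.avg - xs))
    (dx := x (k + 1) - x k) (dv := (u (k + 1) - x (k + 1)) - (u k - x k))
    (a := g.extPseudoGrad (x k) (u k) - g.pseudoGrad xs) (b := c • lap G n (u k))
    (r := z k - zs) (q := lam k - consensus N ls) (dz := z (k + 1) - z k)
    (dl := lam (k + 1) - lam k)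
    (blockScale_symm _) (blockScale_symm _) (blockScale_symm _) (lap_symm G)
    (inner_blockMap_transpose g.A) hκ hD hδ' hcoer
    (by rw [hlq]; exact hrun.scaled_z_step hυ k)
    (by rw [hrun.u_succ_eq]; abel)
    ?_ ?_ ?_ (hlap _)
  · have e1 : x k - xs + (x (k + 1) - x k) = x (k + 1) - xs := by abel
    have e2 : u k - x k - (consensus N xs.avg - xs) + (u (k + 1) - x (k + 1) - (u k - x k))
        = u (k + 1) - x (k + 1) - (consensus N xs.avg - xs) := by abel
    have e3 : z k - zs + (z (k + 1) - z k) = z (k + 1) - zs := by abel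
    have e4 : lam k - consensus N ls + (lam (k + 1) - lam k) = lam (k + 1) - consensus N ls := by
      abel
    rw [e1, e2, e3, e4] at hstep
    exact hstep
  · have h1 := (hrun.x_inequality hg hτ k).2 xs hst.mem_box
    have h2 := hst.primal _ (hrun.x_inequality hg hτ k).1
    have e1 : x k - xs + (x (k + 1) - x k) = x (k + 1) - xs := by abel
    rw [← neg_sub (x (k + 1)) xs, inner_neg_right] at h1
    rw [e1, map_sub (blockMap fun i => (g.A i).transpose)]
    have e2 : blockScale (fun i => (τ i)⁻¹) n (x (k + 1) - x k)
        + (g.extPseudoGrad (x k) (u k) - g.pseudoGrad xs + c • lap G n (u k))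
        + (blockMap (fun i => (g.A i).transpose) (lam k)
          - blockMap (fun i => (g.A i).transpose) (consensus N ls))
        = (blockScale (fun i => (τ i)⁻¹) n (x (k + 1) - x k) + (g.extPseudoGrad (x k) (u k)
          + blockMap (fun i => (g.A i).transpose) (lam k) + c • lap G n (u k)))
          - (g.pseudoGrad xs + blockMap (fun i => (g.A i).transpose) (consensus N ls)) := by abel
    rw [e2, inner_sub_left]
    linarith
  · have e1 : lam k - consensus N ls + (lam (k + 1) - lam k) = lam (k + 1) - consensus N ls := by
      abel
    rw [e1, hlq, PiLp.inner_apply]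
    refine Finset.sum_nonpos fun i _ => ?_
    have h1 := (hrun.lam_inequality hα k i).2 ls hst.mem_orthant
    have h2 := hst.dual i _ (hrun.lam_inequality hα k i).1
    rw [← neg_sub (lam (k + 1) i) ls, inner_neg_right] at h1
    have e2 : (blockScale (fun i => (α i)⁻¹) m (lam (k + 1) - lam k) + lap G m (lam k)
          - blockMap g.A (x k - xs + (2 : ℝ) • (x (k + 1) - x k))
          + lap G m (z k - zs + (2 : ℝ) • (z (k + 1) - z k))) i
        = ((α i)⁻¹ • (lam (k + 1) i - lam k i) + (lap G m (lam k) i + g.b i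
          - Matrix.toEuclideanLin (g.A i) ((2 : ℝ) • x (k + 1) i - x k i)
          + lap G m ((2 : ℝ) • z (k + 1) - z k) i))
          - (g.b i - Matrix.toEuclideanLin (g.A i) (xs i) + lap G m zs i) := by
      have f1 : (x k - xs + (2 : ℝ) • (x (k + 1) - x k)) = ((2 : ℝ) • x (k + 1) - x k) - xs := by
        rw [smul_sub, two_smul ℝ (x k)]; abel
      have f2 : (z k - zs + (2 : ℝ) • (z (k + 1) - z k)) = ((2 : ℝ) • z (k + 1) - z k) - zs := by
        rw [smul_sub, two_smul ℝ (z k)]; abel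
      rw [f1, f2, map_sub (blockMap g.A), map_sub (lap G m) _ zs]
      simp only [PiLp.add_apply, PiLp.sub_apply, blockScale_apply, blockMap_apply, PiLp.smul_apply]
      abel
    rw [e2, PiLp.sub_apply, consensus_apply, inner_sub_left]
    linarith
  · have e1 : x k - xs + (u k - x k - (consensus N xs.avg - xs)) = u k - consensus N xs.avg := by
      abel
    rw [e1]
    exact hcore (x k) (u k) (hrun.avg_eq k)

end Run

/-! ### Limit lemmas. -/

section Limits

open Filter Topology

/-- A nonnegative sequence whose decrements dominate `s ≥ 0` forces `s → 0`. -/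
theorem tendsto_zero_of_decrement {V s : ℕ → ℝ} (hV : ∀ k, 0 ≤ V k) (hs : ∀ k, 0 ≤ s k)
    (h : ∀ k, V (k + 1) ≤ V k - s k) : Tendsto s atTop (𝓝 0) := by
  have hanti : Antitone V := antitone_nat_of_succ_le fun k => by linarith [h k, hs k]
  have hlim := tendsto_atTop_ciInf hanti ⟨0, by rintro _ ⟨k, rfl⟩; exact hV k⟩
  have hdiff : Tendsto (fun k => V k - V (k + 1)) atTop (𝓝 0) := by
    simpa using hlim.sub (hlim.comp (tendsto_add_atTop_nat 1))
  exact squeeze_zero hs (fun k => by linarith [h k]) hdiff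

theorem tendsto_zero_of_antitone_of_subseq {V : ℕ → ℝ} (hV : ∀ k, 0 ≤ V k) (h : Antitone V)
    {φ : ℕ → ℕ} (hφ : StrictMono φ) (hlim : Tendsto (V ∘ φ) atTop (𝓝 0)) :
    Tendsto V atTop (𝓝 0) := by
  have h1 := tendsto_atTop_ciInf h ⟨0, by rintro _ ⟨k, rfl⟩; exact hV k⟩
  have h2 := tendsto_nhds_unique (h1.comp hφ.tendsto_atTop) hlim
  rwa [h2] at h1

theorem tendsto_of_norm_sq_le {E : Type*} [NormedAddCommGroup E] {f : ℕ → E} {a : E} {C : ℝ}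
    {V : ℕ → ℝ} (hC : 0 < C) (h : ∀ k, C * ‖f k - a‖ ^ 2 ≤ V k) (hV : Tendsto V atTop (𝓝 0)) :
    Tendsto f atTop (𝓝 a) := by
  rw [tendsto_iff_norm_sub_tendsto_zero]
  have h1 : Tendsto (fun k => ‖f k - a‖ ^ 2) atTop (𝓝 0) := by
    refine squeeze_zero (fun k => sq_nonneg _) (fun k => ?_) (by simpa using hV.const_mul C⁻¹)
    rw [← div_eq_inv_mul, le_div_iff₀ hC, mul_comm]
    exact h k
  have h2 := h1.sqrt
  simpa [Real.sqrt_sq (norm_nonneg _)] using h2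

theorem tendsto_precondForm_zero {E H : Type*} [NormedAddCommGroup E] [InnerProductSpace ℝ E]
    [NormedAddCommGroup H] [InnerProductSpace ℝ H] [FiniteDimensional ℝ E] [FiniteDimensional ℝ H]
    (T : E →ₗ[ℝ] E) (Y Al L : H →ₗ[ℝ] H) (Λ : E →ₗ[ℝ] H) (κ : ℝ) {p e : ℕ → E} {r q : ℕ → H}
    (hp : Tendsto p atTop (𝓝 0)) (he : Tendsto e atTop (𝓝 0)) (hr : Tendsto r atTop (𝓝 0))
    (hq : Tendsto q atTop (𝓝 0)) :
    Tendsto (fun k => precondForm T Y Al L Λ κ (p k) (e k) (r k) (q k)) atTop (𝓝 0) := by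
  have hT := (T.continuous_of_finiteDimensional.tendsto 0).comp hp
  have hY := (Y.continuous_of_finiteDimensional.tendsto 0).comp hr
  have hAl := (Al.continuous_of_finiteDimensional.tendsto 0).comp hq
  have hL := (L.continuous_of_finiteDimensional.tendsto 0).comp hr
  have hΛ := (Λ.continuous_of_finiteDimensional.tendsto 0).comp hp
  have := ((((((hT.inner (𝕜 := ℝ) hp).add ((he.inner (𝕜 := ℝ) he).const_mul κ⁻¹)).add
    (hY.inner (𝕜 := ℝ) hr)).add (hAl.inner (𝕜 := ℝ) hq)).sub
    ((hΛ.inner (𝕜 := ℝ) hq).const_mul 2)).add ((hL.inner (𝕜 := ℝ) hq).const_mul 2))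
  simpa [precondForm] using this

theorem linearMap_tendsto {E H : Type*} [NormedAddCommGroup E] [NormedSpace ℝ E]
    [NormedAddCommGroup H] [NormedSpace ℝ H] [FiniteDimensional ℝ E] (T : E →ₗ[ℝ] H) {f : ℕ → E}
    {a : E} (h : Tendsto f atTop (𝓝 a)) : Tendsto (fun k => T (f k)) atTop (𝓝 (T a)) :=
  (T.continuous_of_finiteDimensional.tendsto a).comp h

theorem tendsto_block {N d : ℕ} {f : ℕ → Profile N d} {a : Profile N d}
    (h : Tendsto f atTop (𝓝 a)) (i : Fin N) : Tendsto (fun k => f k i) atTop (𝓝 (a i)) :=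
  ((PiLp.continuous_apply 2 (fun _ : Fin N => Euc d) i).tendsto a).comp h

theorem continuous_consensus_avg (N d : ℕ) :
    Continuous fun x : Profile N d => consensus N x.avg :=
  PiLp.continuous_toLp 2 _ |>.comp <| continuous_pi fun _ =>
    (continuous_finsetSum _ fun i _ => PiLp.continuous_apply 2 _ i).const_smul (1 / (N : ℝ))

end Limits

/-! ### Convergence of the iterates. -/

section Convergence

open Filter Topology

variable {N n m : ℕ} {g : AggGame N n m} {G : SimpleGraph (Fin N)} [DecidableRel G.Adj]
  {c κ : ℝ} {τ υ α : Fin N → ℝ} {x u : ℕ → Profile N n} {z lam : ℕ → Profile N m}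

/-- Cluster points of the dual iterates are stationary, once the primal iterates converge and the
dual increments vanish. -/
theorem IsRun.isStationary_of_cluster (hN : 2 ≤ N) (hl2 : 0 < lambdaTwo hN G)
    (hrun : IsRun g G c κ τ υ α x u z lam) (hg : g.Regular)
    (hτ : ∀ i, 0 < τ i) (hυ : ∀ i, 0 < υ i) (hα : ∀ i, 0 < α i)
    {xs : Profile N n} (hxs : xs ∈ g.box) (hx : Tendsto x atTop (𝓝 xs))
    (hu : Tendsto u atTop (𝓝 (consensus N xs.avg)))
    (hF : Tendsto (fun k => g.extPseudoGrad (x k) (u k)) atTop (𝓝 (g.pseudoGrad xs)))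
    (hdz : Tendsto (fun k => z (k + 1) - z k) atTop (𝓝 0))
    (hdl : Tendsto (fun k => lam (k + 1) - lam k) atTop (𝓝 0)) {φ : ℕ → ℕ} (hφ : StrictMono φ)
    {zs ls : Profile N m} (hz : Tendsto (z ∘ φ) atTop (𝓝 zs))
    (hl : Tendsto (lam ∘ φ) atTop (𝓝 ls)) :
    ls = consensus N ls.avg ∧ g.IsStationary G xs zs ls.avg := by
  have hφt := hφ.tendsto_atTop
  -- The scaled z-increment equals Lλ, so vanishing increments force consensus of the multipliers.
  have hlap0 : lap G m ls = 0 := by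
    have h1 := linearMap_tendsto (lap G m) hl
    have h2 := linearMap_tendsto (blockScale (fun i => (υ i)⁻¹) m) (hdz.comp hφt)
    rw [map_zero] at h2
    refine tendsto_nhds_unique h1 (h2.congr fun k => ?_)
    exact hrun.scaled_z_step hυ (φ k)
  have hcons := eq_consensus_of_lap_eq_zero G hN hl2 hlap0
  have hlsi : ∀ i, ls i = ls.avg := fun i => by
    conv_lhs => rw [hcons]
    rfl
  have hx1 : Tendsto (fun k => x (φ k + 1)) atTop (𝓝 xs) :=
    hx.comp ((tendsto_add_atTop_nat 1).comp hφt)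
  have hx0 : Tendsto (fun k => x (φ k)) atTop (𝓝 xs) := hx.comp hφt
  have hz1 : Tendsto (fun k => z (φ k + 1)) atTop (𝓝 zs) := by
    simpa using hz.add (hdz.comp hφt)
  have hl1 : Tendsto (fun k => lam (φ k + 1)) atTop (𝓝 ls) := by
    simpa using hl.add (hdl.comp hφt)
  have hlap_u : Tendsto (fun k => lap G n (u (φ k))) atTop (𝓝 0) := by
    have := linearMap_tendsto (lap G n) (hu.comp hφt)
    rwa [lap_consensus] at this
  refine ⟨hcons, hxs, ?_, fun y hy => ?_, fun i y hy => ?_⟩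
  · have hi : Fin N := ⟨0, by omega⟩
    rw [← hlsi hi]
    exact (isClosed_orthant m).mem_of_tendsto (tendsto_block hl1 hi)
      (Eventually.of_forall fun k => (hrun.lam_inequality hα (φ k) hi).1)
  · rw [← hcons]
    have h1 := linearMap_tendsto (blockScale (fun i => (τ i)⁻¹) n) (hx1.sub hx0)
    rw [sub_self, map_zero] at h1
    have h2 := linearMap_tendsto (blockMap fun i => (g.A i).transpose) hl
    have h3 := h1.add (((hF.comp hφt).add h2).add (hlap_u.const_smul c))
    rw [smul_zero, add_zero, zero_add] at h3
    exact ge_of_tendsto' (h3.inner (𝕜 := ℝ) (tendsto_const_nhds.sub hx1))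
      fun k => (hrun.x_inequality hg hτ (φ k)).2 y hy
  · have h1 := ((tendsto_block hl1 i).sub (tendsto_block hl i)).const_smul (α i)⁻¹
    rw [sub_self, smul_zero] at h1
    have h2 := tendsto_block (linearMap_tendsto (lap G m) hl) i
    rw [hlap0] at h2
    have h3 := linearMap_tendsto (Matrix.toEuclideanLin (g.A i))
      (((tendsto_block hx1 i).const_smul (2 : ℝ)).sub (tendsto_block hx0 i))
    have h4 := tendsto_block (linearMap_tendsto (lap G m) ((hz1.const_smul (2 : ℝ)).sub hz)) i
    have h5 := h1.add (((h2.add_const (g.b i)).sub h3).add h4)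
    have h6 := ge_of_tendsto' (h5.inner (𝕜 := ℝ) (tendsto_const_nhds.sub (tendsto_block hl1 i)))
      fun k => (hrun.lam_inequality hα (φ k) i).2 y hy
    have e1 : (2 : ℝ) • xs i - xs i = xs i := by rw [two_smul]; abel
    have e2 : (2 : ℝ) • zs - zs = zs := by rw [two_smul]; abel
    rw [e1, e2, hlsi i, PiLp.zero_apply, zero_add, zero_add] at h6
    exact h6

/-- Convergence of the iteration from the descent inequality. -/
theorem IsRun.tendsto (hN : 2 ≤ N) (hl2 : 0 < lambdaTwo hN G)
    (hrun : IsRun g G c κ τ υ α x u z lam) (hg : g.Regular)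
    (hτ : ∀ i, 0 < τ i) (hυ : ∀ i, 0 < υ i) (hα : ∀ i, 0 < α i) (hκ : 0 < κ)
    {lu lx : ℝ}
    (hext_u : ∀ x u v : Profile N n,
      ‖g.extPseudoGrad x u - g.extPseudoGrad x v‖ ≤ lu * ‖u - v‖)
    (hext_x : ∀ x y u : Profile N n,
      ‖g.extPseudoGrad x u - g.extPseudoGrad y u‖ ≤ lx * ‖x - y‖)
    {D δ δ' ε : ℝ} (hD : 0 < D) (hδ : 0 < δ) (hδ' : 0 < δ') (hδδ' : δ' < δ) (hε : 0 < ε)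
    (hcoer : ∀ (x v : Profile N n) (z l : Profile N m),
      D * ‖x‖ ^ 2 + κ⁻¹ * ‖v‖ ^ 2 + δ * ‖z‖ ^ 2 + δ * ‖l‖ ^ 2
      ≤ precondForm (blockScale (fun i => (τ i)⁻¹) n) (blockScale (fun i => (υ i)⁻¹) m)
          (blockScale (fun i => (α i)⁻¹) m) (lap G m) (blockMap g.A) κ x v z l)
    {xs : Profile N n} {ls₀ : Euc m} (hkkt : g.IsKKT xs ls₀)
    (hcore : ∀ x u : Profile N n, u.avg = x.avg →
      D⁻¹ * ‖(g.extPseudoGrad x u - g.pseudoGrad xs) + c • lap G n u‖ ^ 2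
        + κ * ‖c • lap G n u‖ ^ 2 + ε * (‖x - xs‖ ^ 2 + ‖u - consensus N u.avg‖ ^ 2)
      ≤ 2 * (⟪g.extPseudoGrad x u - g.pseudoGrad xs, x - xs⟫_ℝ
          + ⟪c • lap G n u, u - consensus N xs.avg⟫_ℝ))
    (hlap : ∀ q : Profile N m, ‖lap G m q‖ ^ 2 ≤ 2 * δ' * ⟪lap G m q, q⟫_ℝ) :
    Tendsto x atTop (𝓝 xs) ∧ Tendsto u atTop (𝓝 (consensus N xs.avg)) ∧
      ∃ ls : Euc m, g.IsKKT xs ls ∧ Tendsto lam atTop (𝓝 (consensus N ls)) := by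
  obtain ⟨zs₀, hst₀⟩ := hkkt.exists_isStationary hN hl2
  -- The dual reference (zs, ls) is left free: the descent is used first for a known stationary
  -- point and later for the cluster point.
  have hdec : ∀ {zs : Profile N m} {ls : Euc m}, g.IsStationary G xs zs ls → ∀ k,
      lyapunov g G κ τ υ α xs zs ls (x (k + 1)) (u (k + 1)) (z (k + 1)) (lam (k + 1))
        ≤ lyapunov g G κ τ υ α xs zs ls (x k) (u k) (z k) (lam k)
          - (ε * (‖x k - xs‖ ^ 2 + ‖u k - consensus N (u k).avg‖ ^ 2)
          + (δ - δ') * ‖lam (k + 1) - lam k‖ ^ 2 + δ * ‖z (k + 1) - z k‖ ^ 2) :=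
    fun hst k => (hrun.lyapunov_succ_le hg hτ hυ hα hκ hD hδ' hcoer hst hcore hlap k).trans_eq
      (by ring)
  have hge : ∀ (zs : Profile N m) (ls : Euc m) (k : ℕ),
      δ * ‖z k - zs‖ ^ 2 + δ * ‖lam k - consensus N ls‖ ^ 2
        ≤ lyapunov g G κ τ υ α xs zs ls (x k) (u k) (z k) (lam k) := by
    intro zs ls k
    have h1 := hcoer (x k - xs) ((u k - x k) - (consensus N xs.avg - xs)) (z k - zs)
      (lam k - consensus N ls)
    have h2 : 0 ≤ D * ‖x k - xs‖ ^ 2 := by positivity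
    have h3 : 0 ≤ κ⁻¹ * ‖(u k - x k) - (consensus N xs.avg - xs)‖ ^ 2 := by positivity
    unfold lyapunov
    linarith
  have hV0 : ∀ (zs : Profile N m) (ls : Euc m) (k : ℕ),
      0 ≤ lyapunov g G κ τ υ α xs zs ls (x k) (u k) (z k) (lam k) := fun zs ls k =>
    le_trans (by positivity) (hge zs ls k)
  have hdd : 0 < δ - δ' := by linarith
  have hs0 : ∀ k, 0 ≤ ε * (‖x k - xs‖ ^ 2 + ‖u k - consensus N (u k).avg‖ ^ 2)
      + (δ - δ') * ‖lam (k + 1) - lam k‖ ^ 2 + δ * ‖z (k + 1) - z k‖ ^ 2 := fun k => by positivity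
  have hs := tendsto_zero_of_decrement (hV0 zs₀ ls₀) hs0 (hdec hst₀)
  have hanti : ∀ {zs : Profile N m} {ls : Euc m}, g.IsStationary G xs zs ls →
      Antitone fun k => lyapunov g G κ τ υ α xs zs ls (x k) (u k) (z k) (lam k) :=
    fun hst => antitone_nat_of_succ_le fun k => by linarith [hdec hst k, hs0 k]
  have e1 : ∀ k, 0 ≤ ε * ‖x k - xs‖ ^ 2 := fun k => by positivity
  have e2 : ∀ k, 0 ≤ ε * ‖u k - consensus N (u k).avg‖ ^ 2 := fun k => by positivity
  have e3 : ∀ k, 0 ≤ (δ - δ') * ‖lam (k + 1) - lam k‖ ^ 2 := fun k => by positivity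
  have e4 : ∀ k, 0 ≤ δ * ‖z (k + 1) - z k‖ ^ 2 := fun k => by positivity
  have hx : Tendsto x atTop (𝓝 xs) :=
    tendsto_of_norm_sq_le hε (fun k => by linarith [e1 k, e2 k, e3 k, e4 k]) hs
  have hu0 : Tendsto (fun k => u k - consensus N (u k).avg) atTop (𝓝 0) :=
    tendsto_of_norm_sq_le hε
      (fun k => by rw [sub_zero]; linarith [e1 k, e2 k, e3 k, e4 k]) hs
  have hdl : Tendsto (fun k => lam (k + 1) - lam k) atTop (𝓝 0) :=
    tendsto_of_norm_sq_le hdd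
      (fun k => by rw [sub_zero]; linarith [e1 k, e2 k, e3 k, e4 k]) hs
  have hdz : Tendsto (fun k => z (k + 1) - z k) atTop (𝓝 0) :=
    tendsto_of_norm_sq_le hδ
      (fun k => by rw [sub_zero]; linarith [e1 k, e2 k, e3 k, e4 k]) hs
  -- Disagreement vanishes and the average of u is that of x, which converges.
  have hu : Tendsto u atTop (𝓝 (consensus N xs.avg)) := by
    have h1 := ((continuous_consensus_avg N n).tendsto xs).comp hx
    have h2 := hu0.add h1
    rw [zero_add] at h2
    refine h2.congr fun k => ?_
    simp only [Function.comp_apply, hrun.avg_eq, sub_add_cancel]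
  have hF : Tendsto (fun k => g.extPseudoGrad (x k) (u k)) atTop (𝓝 (g.pseudoGrad xs)) := by
    rw [tendsto_iff_norm_sub_tendsto_zero]
    have h1 := ((tendsto_iff_norm_sub_tendsto_zero.1 hx).const_mul lx).add
      ((tendsto_iff_norm_sub_tendsto_zero.1 hu).const_mul lu)
    rw [mul_zero, mul_zero, add_zero] at h1
    refine squeeze_zero (fun k => norm_nonneg _) (fun k => ?_) h1
    rw [← AggGame.extPseudoGrad_consensus]
    exact (norm_sub_le_norm_sub_add_norm_sub _ (g.extPseudoGrad xs (u k)) _).trans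
      (add_le_add (hext_x _ _ _) (hext_u _ _ _))
  obtain ⟨R, hR⟩ : ∃ R, ∀ k, ‖z k - zs₀‖ ^ 2 ≤ R ∧ ‖lam k - consensus N ls₀‖ ^ 2 ≤ R := by
    refine ⟨δ⁻¹ * lyapunov g G κ τ υ α xs zs₀ ls₀ (x 0) (u 0) (z 0) (lam 0), fun k => ?_⟩
    have h1 := (hge zs₀ ls₀ k).trans (hanti hst₀ (Nat.zero_le k))
    have h2 : 0 ≤ δ * ‖z k - zs₀‖ ^ 2 := by positivity
    have h3 : 0 ≤ δ * ‖lam k - consensus N ls₀‖ ^ 2 := by positivity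
    rw [← div_eq_inv_mul, le_div_iff₀ hδ, le_div_iff₀ hδ]
    constructor <;> linarith
  have hbdd : ∀ k, (z k, lam k) ∈ Metric.closedBall zs₀ (√R) ×ˢ
      Metric.closedBall (consensus N ls₀) (√R) := fun k => by
    simp only [Set.mem_prod, mem_closedBall_iff_norm]
    exact ⟨Real.le_sqrt_of_sq_le (hR k).1, Real.le_sqrt_of_sq_le (hR k).2⟩
  obtain ⟨⟨zs, ls⟩, _, φ, hφ, hlim⟩ := ((isCompact_closedBall zs₀ (√R)).prod
    (isCompact_closedBall (consensus N ls₀) (√R))).tendsto_subseq hbdd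
  have hz : Tendsto (z ∘ φ) atTop (𝓝 zs) := (continuous_fst.tendsto _).comp hlim
  have hl : Tendsto (lam ∘ φ) atTop (𝓝 ls) := (continuous_snd.tendsto _).comp hlim
  obtain ⟨hcons, hst⟩ := hrun.isStationary_of_cluster hN hl2 hg hτ hυ hα hst₀.mem_box hx hu hF hdz
    hdl hφ hz hl
  -- Measured from the cluster point itself, the distance vanishes along the subsequence;
  -- monotonicity extends this to the whole sequence.
  have hVφ : Tendsto ((fun k => lyapunov g G κ τ υ α xs zs ls.avg (x k) (u k) (z k) (lam k)) ∘ φ)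
      atTop (𝓝 0) := by
    have hφt := hφ.tendsto_atTop
    refine tendsto_precondForm_zero _ _ _ _ _ _ ?_ ?_ ?_ ?_
    · simpa using (hx.comp hφt).sub_const xs
    · simpa using ((hu.comp hφt).sub (hx.comp hφt)).sub_const (consensus N xs.avg - xs)
    · simpa using hz.sub_const zs
    · rw [← hcons]
      simpa using hl.sub_const ls
  have hV := tendsto_zero_of_antitone_of_subseq (hV0 zs ls.avg) (hanti hst) hφ hVφ
  refine ⟨hx, hu, ls.avg, hst.isKKT, tendsto_of_norm_sq_le hδ (fun k => ?_) hV⟩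
  have h1 : 0 ≤ δ * ‖z k - zs‖ ^ 2 := by positivity
  linarith [hge zs ls.avg k]

end Convergence

end

/-! ### Assembly: choice of constants. -/

theorem theorem1 {N n m : ℕ} (hN : 2 ≤ N) (g : AggGame N n m)
    (G : SimpleGraph (Fin N)) [DecidableRel G.Adj]
    (hreg : g.Regular) (hconn : G.Connected)
    {μ lF lu lx : ℝ} (hμ : 0 < μ) (hlF : 0 < lF) (hlu : 0 < lu) (hlx : 0 < lx)
    (hF_mono : ∀ x y : Profile N n,
      μ * ‖x - y‖ ^ 2 ≤ inner ℝ (x - y) (g.pseudoGrad x - g.pseudoGrad y))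
    (hF_lip : ∀ x y : Profile N n, ‖g.pseudoGrad x - g.pseudoGrad y‖ ≤ lF * ‖x - y‖)
    (hext_u : ∀ x u v : Profile N n,
      ‖g.extPseudoGrad x u - g.extPseudoGrad x v‖ ≤ lu * ‖u - v‖)
    (hext_x : ∀ x y u : Profile N n,
      ‖g.extPseudoGrad x u - g.extPseudoGrad y u‖ ≤ lx * ‖x - y‖)
    {c δ κ : ℝ} {τ υ α : Fin N → ℝ} (hc : 0 < c) (hκ_pos : 0 < κ)
    (hcl : lu ^ 2 / (4 * μ) < c * lambdaTwo hN G)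
    (hδ : 1 / (2 * betaConst hN G μ lu lx c) < δ)
    (hκ : κ < 1 / δ)
    (hsteps : StepSizesOK g G δ κ τ υ α) :
    ∃ xs : Profile N n,
      g.IsVariationalGNE xs ∧ (∀ y, g.IsVariationalGNE y → y = xs) ∧ g.IsGNE xs ∧
      ∀ (x u : ℕ → Profile N n) (z lam : ℕ → Profile N m),
        IsRun g G c κ τ υ α x u z lam →
        (∀ i, Filter.Tendsto (fun k => x k i) Filter.atTop (nhds (xs i))) ∧
        (∀ i, Filter.Tendsto (fun k => u k i) Filter.atTop (nhds xs.avg)) ∧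
        ∃ ls : Euc m, g.IsKKT xs ls ∧
          ∀ i, Filter.Tendsto (fun k => lam k i) Filter.atTop (nhds ls) := by
  obtain ⟨xs, hxs⟩ := hreg.exists_isVariationalGNE hμ hlF hF_mono hF_lip
  refine ⟨xs, hxs, fun y hy => hy.eq hμ hF_mono hxs, hreg.isGNE_of_isVariationalGNE hxs,
    fun x u z lam hrun => ?_⟩
  have hcl2 : 0 < c * lambdaTwo hN G := lt_of_le_of_lt (by positivity) hcl
  -- Positivity of λ₂(L) is read off the gain condition.
  have hl2 : 0 < lambdaTwo hN G := pos_of_mul_pos_right hcl2 hc.le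
  have hmax : 0 < lambdaMax hN G := hl2.trans_le (lambdaTwo_le_lambdaMax G hN)
  have hmu : 0 < muTilde μ lu (c * lambdaTwo hN G) := muTilde_pos hμ hcl
  set Θ := max (lx ^ 2) (lu ^ 2 + (c * lambdaMax hN G) ^ 2) with hΘ
  have hΘ0 : 0 < Θ := lt_of_lt_of_le (by positivity) (le_max_left _ _)
  set β := betaConst hN G μ lu lx c with hβ
  have hβ1 : β ≤ muTilde μ lu (c * lambdaTwo hN G) / Θ := min_le_left _ _
  have hβ2 : β ≤ 1 / lambdaMax hN G := min_le_right _ _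
  have hβ0 : 0 < β := lt_min (div_pos hmu hΘ0) (one_div_pos.2 hmax)
  have hδ' : 0 < 1 / (2 * β) := by positivity
  have hδ0 : 0 < δ := hδ'.trans hδ
  have hκδ : κ * δ < 1 := (lt_div_iff₀ hδ0).1 hκ
  have hD : 0 < δ + 1 / (κ * (1 - κ * δ)) := by
    have : 0 < 1 - κ * δ := by linarith
    positivity
  -- The first entry of the minimum in β serves the primal descent: δ > 1/(2β) ≥ Θ/(2μ̃).
  have hε : 0 < 2 * muTilde μ lu (c * lambdaTwo hN G) - Θ / δ := by
    rw [sub_pos, div_lt_iff₀ hδ0]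
    rw [le_div_iff₀ hΘ0] at hβ1
    rw [div_lt_iff₀ (by positivity)] at hδ
    have h1 : Θ * 1 < Θ * (δ * (2 * β)) := mul_lt_mul_of_pos_left hδ hΘ0
    have h2 : (2 * δ) * (β * Θ) ≤ (2 * δ) * muTilde μ lu (c * lambdaTwo hN G) :=
      mul_le_mul_of_nonneg_left hβ1 (by positivity)
    linarith
  -- The second entry serves the dual descent: with δ' = 1/(2β), 2δ' = 1/β ≥ λ_N(L).
  have hlap : ∀ q : Profile N m,
      ‖lap G m q‖ ^ 2 ≤ 2 * (1 / (2 * β)) * ⟪lap G m q, q⟫_ℝ := by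
    intro q
    have h1 := norm_lap_sq_le G hN q
    have h2 : 0 ≤ ⟪lap G m q, q⟫_ℝ :=
      nonneg_of_mul_nonneg_right ((sq_nonneg _).trans h1) hmax
    refine h1.trans (mul_le_mul_of_nonneg_right ?_ h2)
    have h3 : 2 * (1 / (2 * β)) = 1 / β := by field_simp
    rw [h3]
    exact (le_one_div hβ0 hmax).1 hβ2
  obtain ⟨ls₀, hkkt⟩ := hreg.exists_isKKT hxs
  obtain ⟨h1, h2, ls, h3, h4⟩ := hrun.tendsto hN hl2 hreg hsteps.tau_pos hsteps.upsilon_pos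
    hsteps.alpha_pos hκ_pos hext_u hext_x hD hδ0 hδ' hδ hε
    (hsteps.precondForm_ge hδ0 hκ_pos hκδ) hkkt
    (fun x u h => g.forward_cocoercive hN G hlu hlx hF_mono hext_u hext_x hc hδ0 hκ_pos hκδ hl2
      xs x u h) hlap
  exact ⟨tendsto_block h1, tendsto_block h2, ls, h3, tendsto_block h4⟩
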